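/- Let $\mathscr F$ be a finite set of functions $F:\{0,1\}^{k}\to\mathbb C$ (with arity $k\ge 1$ depending on $F$) all of whose values are algebraic numbers. An instance $I$ of $\#\mathrm{CSP}(\mathscr F)$ consists of variables $v_1,\dots,v_n$ and a finite list (repetitions allowed) of constraints $F(v_{i_1},\dots,v_{i_k})$ with $F\in\mathscr F$; the required output is $$Z(I)=\sum_{v_1,\dots,v_n\in\{0,1\}}\ \prod_{\text{constraints of } I}F(v_{i_1},\dots,v_{i_k}).$$ Let $\delta_0,\delta_1$ be the unary functions with $\delta_0(0)=1,\ \delta_0(1)=0$ and $\delta_1(0)=0,\ \delta_1(1)=1$. For a positive integer $D$ and a real $\varepsilon>0$, say that $\#\mathrm{CSP}(\mathscr F)$ has an $O(2^{\varepsilon n})$ time algorithm at degree $\le D$ if some deterministic algorithm returns $Z(I)$ exactly, in at most $C\cdot 2^{\varepsilon n}$ steps for a constant $C$, for every instance $I$ in which every variable appears in at most $D$ constraints, where $n$ is the number of variables of $I$. Here time is counted in a step-counting model polynomially equivalent to multitape Turing machines, and $Z(I)$ is returned through its rational coordinates (integer numerators over one positive common denominator, all in binary) in a fixed $\mathbb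 Q$-basis of the number field generated by the values of the functions in $\mathscr F$. **Theorem.** If there exist a real $\varepsilon>0$ and an integer $D>0$ such that $\#\mathrm{CSP}(\mathscr F\cup\{\delta_0,\delta_1\})$ has no $O(2^{\varepsilon n})$ time algorithm at degree $\le D$, then there exist a real $\varepsilon'>0$ and an integer $D'>0$ such that $\#\mathrm{CSP}(\mathscr F)$ has no $O(2^{\varepsilon' N})$ time algorithm at degree $\le D'$, where $n$ and $N$ denote the numbers of variables of the respective instances. -/

import Mathlib

namespace PinCSP

/-! ### Boolean constraint functions and counting CSPs -/

/-- A complex-valued function of finitely many Boolean variables. -/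
structure BoolFn where
  arity : ℕ
  toFun : (Fin arity → Bool) → ℂ

/-- The unary function `[1, 0]`, which forces its variable to be `0`. -/
def delta0 : BoolFn := ⟨1, fun x => if x 0 = false then 1 else 0⟩

/-- The unary function `[0, 1]`, which forces its variable to be `1`. -/
def delta1 : BoolFn := ⟨1, fun x => if x 0 = true then 1 else 0⟩

/-- A constraint `f (v_{i_1}, …, v_{i_k})` with `f ∈ F` on the variables `v_0, …, v_{n-1}`;
a variable may occupy several arguments. -/
structure Cstr (F : Set BoolFn) (n : ℕ) where
  fn : BoolFn
  mem : fn ∈ F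
  vars : Fin fn.arity → Fin n

/-- An instance of `#CSP(F)`: a number of variables and finitely many constraints on them
(the same constraint may be imposed several times). -/
structure Inst (F : Set BoolFn) where
  numVars : ℕ
  cstrs : List (Cstr F numVars)

/-- The output `Z(I)`: the sum, over all Boolean assignments, of the product of the values of
the constraints. -/
noncomputable def Inst.value {F : Set BoolFn} (I : Inst F) : ℂ :=
  ∑ σ : Fin I.numVars → Bool, (I.cstrs.map fun c => c.fn.toFun fun j => σ (c.vars j)).prod

/-- Every variable appears in at most `D` constraints (counted with multiplicity). -/
def Inst.DegreeLE {F : Set BoolFn} (I : Inst F) (D : ℕ) : Prop :=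
  ∀ v : Fin I.numVars, I.cstrs.countP (fun c => decide (∃ j, c.vars j = v)) ≤ D

/-! ### The model of computation

Deterministic `while` programs over binary trees, with a step count. The basic operations only
follow or create pointers: a tree is held in memory as a pointer to a node, so that every step
touches a bounded number of pointers and creates at most one node. The model simulates, and is
simulated by, multitape Turing machines with polynomial overhead. -/

/-- The data of a program: binary trees. -/
inductive Data where
  | leaf : Data
  | node : Data → Data → Data

/-- Left subtree (a leaf has none, and is returned itself). -/
def Data.hd : Data → Data
  | .leaf => .leaf
  | .node a _ => a

/-- Right subtree (a leaf has none, and is returned itself). -/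
def Data.tl : Data → Data
  | .leaf => .leaf
  | .node _ b => b

/-- Programs. Each maps an input tree to an output tree, if it halts. -/
inductive Prog where
  /-- return the input -/
  | skip : Prog
  /-- return a leaf -/
  | leaf : Prog
  /-- return the left subtree of the input -/
  | hd : Prog
  /-- return the right subtree of the input -/
  | tl : Prog
  /-- run both programs on the input, and join the two results by a new node -/
  | pair : Prog → Prog → Prog
  /-- run the first program, then the second one on its result -/
  | seq : Prog → Prog → Prog
  /-- run the first program on the input as a test: if it returns a node, run the second program
  on the input, and if it returns a leaf, run the third one on the input -/
  | cond : Prog → Prog → Prog → Prog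
  /-- `while test x is a node do x := body x`; return `x` -/
  | loop : Prog → Prog → Prog

/-- `Run p x y t`: on input `x` the program `p` halts after exactly `t` steps with output `y`. -/
inductive Run : Prog → Data → Data → ℕ → Prop where
  | skip (x : Data) : Run .skip x x 1
  | leaf (x : Data) : Run .leaf x .leaf 1
  | hd (x : Data) : Run .hd x x.hd 1
  | tl (x : Data) : Run .tl x x.tl 1
  | pair {p q : Prog} {x y z : Data} {s t : ℕ} :
      Run p x y s → Run q x z t → Run (.pair p q) x (.node y z) (s + t + 1)
  | seq {p q : Prog} {x y z : Data} {s t : ℕ} :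
      Run p x y s → Run q y z t → Run (.seq p q) x z (s + t + 1)
  | cond_node {c p q : Prog} {x a b y : Data} {s t : ℕ} :
      Run c x (.node a b) s → Run p x y t → Run (.cond c p q) x y (s + t + 1)
  | cond_leaf {c p q : Prog} {x y : Data} {s t : ℕ} :
      Run c x .leaf s → Run q x y t → Run (.cond c p q) x y (s + t + 1)
  | loop_node {c p : Prog} {x a b y z : Data} {s t u : ℕ} :
      Run c x (.node a b) s → Run p x y t → Run (.loop c p) y z u →
        Run (.loop c p) x z (s + t + u + 1)
  | loop_leaf {c p : Prog} {x : Data} {s : ℕ} :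
      Run c x .leaf s → Run (.loop c p) x x (s + 1)

/-! ### Inputs and outputs as trees -/

/-- A list of trees as one tree. -/
def encList : List Data → Data
  | [] => .leaf
  | a :: l => .node a (encList l)

/-- A natural number in unary. Only names of functions, names of variables and the number of
variables are written so, which keeps the size of a bounded-degree input polynomial in the
number of variables. -/
def encUnary (n : ℕ) : Data := encList (List.replicate n .leaf)

/-- A bit. -/
def encBool : Bool → Data
  | false => .leaf
  | true => .node .leaf .leaf

/-- A natural number in binary, least significant bit first, without leading zeros. -/
def encNat (n : ℕ) : Data := encList (n.bits.map encBool)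

/-- An integer: a sign bit and the absolute value in binary. -/
def encInt (z : ℤ) : Data := .node (encBool (decide (z < 0))) (encNat z.natAbs)

/-- A constraint: the name of its function and the list of its variables. -/
def Cstr.enc {F : Set BoolFn} {n : ℕ} (name : BoolFn → ℕ) (c : Cstr F n) : Data :=
  .node (encUnary (name c.fn)) (encList (List.ofFn fun j => encUnary (c.vars j)))

/-- An instance: the number of variables and the list of the constraints. -/
def Inst.enc {F : Set BoolFn} (name : BoolFn → ℕ) (I : Inst F) : Data :=
  .node (encUnary I.numVars) (encList (I.cstrs.map (Cstr.enc name)))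

/-- The subfield of `ℂ` generated by all values of the functions in `F`. It contains all outputs
of `#CSP(F)`, and is a number field if `F` is finite and its functions have algebraic values. -/
noncomputable def valueField (F : Set BoolFn) : IntermediateField ℚ ℂ :=
  IntermediateField.adjoin ℚ {z | ∃ f ∈ F, ∃ x, z = f.toFun x}

/-- The finite family `ω` of complex numbers is a basis over `ℚ` of the value field of `F`. -/
def IsValueBasis (F : Set BoolFn) {r : ℕ} (ω : Fin r → ℂ) : Prop :=
  LinearIndependent ℚ ω ∧ ∀ z : ℂ, z ∈ Submodule.span ℚ (Set.range ω) ↔ z ∈ valueField F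

/-- The tree `y` represents the complex number `w` in the basis `ω`: it consists of a positive
denominator `q` and integers `z_i`, all in binary, with `w = (∑ i, z_i ω_i) / q`. -/
def Represents {r : ℕ} (ω : Fin r → ℂ) (y : Data) (w : ℂ) : Prop :=
  ∃ (q : ℕ) (z : Fin r → ℤ), 0 < q ∧
    y = .node (encNat q) (encList (List.ofFn fun i => encInt (z i))) ∧
    w = (∑ i, (z i : ℂ) * ω i) / (q : ℂ)

/-- There is an `O(2 ^ (ε n))` time algorithm for `#CSP(F)` restricted to the instances in which
every variable appears in at most `D` constraints, where `n` is the number of variables: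
for some naming of the functions of `F` and some basis of the value field, one program returns
the exact output of every such instance in at most `C * 2 ^ (ε n)` steps. For finite `F`, neither
the naming nor the basis matters, as a change of either is hard-wired into a program. -/
def HasAlgorithm (F : Set BoolFn) (D : ℕ) (ε : ℝ) : Prop :=
  ∃ (name : BoolFn → ℕ) (r : ℕ) (ω : Fin r → ℂ) (p : Prog) (C : ℝ),
    Set.InjOn name F ∧ IsValueBasis F ω ∧
    ∀ I : Inst F, I.DegreeLE D →
      ∃ (y : Data) (t : ℕ), Run p (I.enc name) y t ∧ Represents ω y I.value ∧
        (t : ℝ) ≤ C * (2 : ℝ) ^ (ε * (I.numVars : ℝ))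

end PinCSP

open PinCSP

/-!
The pins `δ₀` and `δ₁` are simulated by a path of `2 m + 1` new variables, one block of two
vertices for every `d` old variables. If some function in `F` is not constant, identifying its
arguments with one of two variables and interpolating affinely gives a binomial `α + β · g` that
vanishes at `(0, 0)` and equals `1` at `(0, 1)`. The same is possible with `(1, 1)` in place of
`(0, 0)`, and with `(1, 0)` unless all functions in `F` are invariant under complementation. The
product of these binomials over the edges of the path forces the alternating assignment; in the
invariant case it also admits the complementary one, which contributes the same amount. The
variable `v` pinned to `0` or `1` is then replaced by an end of the path's block number `v / d`,
so that the degrees remain bounded.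

Expanding the product gives `2 ^ O(n / d)` instances of `#CSP(F)`, whose values are combined by
linear arithmetic in a basis of the value field, in which multiplication by a constant is a
matrix. On top of the oracle calls the running time is polynomial in the number of terms and the
time of the oracle, of a degree `B` that depends neither on `d` nor on the oracle. Hence the total
is `O(2 ^ (ε n))` as soon as the number of terms and each oracle call are `O(2 ^ (δ n))` for
`δ = ε / (B + 1)`, and this is achieved by first taking `d` large, then an oracle with exponent
`δ / 3`, as the new instances have at most `3 n + 3` variables.
-/

namespace PinCSP

/-! ### Programs on trees -/

/-- The height of a tree, our measure of the length of an input. Unlike the number of nodes, it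
grows by at most one with each step of a program, although `Prog.pair` may duplicate its input. -/
def Data.height : Data → ℕ
  | .leaf => 0
  | .node a b => max a.height b.height + 1

@[simp] theorem Data.height_leaf : Data.leaf.height = 0 := rfl

@[simp] theorem Data.height_node (a b : Data) :
    (Data.node a b).height = max a.height b.height + 1 := rfl

theorem Run.height_le {p : Prog} {x y : Data} {t : ℕ} (h : Run p x y t) :
    y.height ≤ x.height + t := by
  induction h with
  | skip x => omega
  | leaf x => simp
  | hd x => cases x <;> simp only [Data.hd, Data.height_leaf, Data.height_node] <;> omega
  | tl x => cases x <;> simp only [Data.tl, Data.height_leaf, Data.height_node] <;> omega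
  | pair _ _ ih₁ ih₂ => simp only [Data.height_node]; omega
  | seq _ _ ih₁ ih₂ => omega
  | cond_node _ _ _ ih₂ => omega
  | cond_leaf _ _ _ ih₂ => omega
  | loop_node _ _ _ _ ih₂ ih₃ => omega
  | loop_leaf _ _ => omega

/-- On input `x` the program `p` halts within `T` steps with output `y`. -/
def RunWithin (p : Prog) (x y : Data) (T : ℕ) : Prop := ∃ t, t ≤ T ∧ Run p x y t

namespace RunWithin

variable {p q c : Prog} {x y z a b : Data} {S T U : ℕ}

theorem mono (h : RunWithin p x y S) (hST : S ≤ T) : RunWithin p x y T :=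
  let ⟨t, ht, hrun⟩ := h
  ⟨t, ht.trans hST, hrun⟩

theorem height_le (h : RunWithin p x y T) : y.height ≤ x.height + T :=
  let ⟨_, ht, hrun⟩ := h
  hrun.height_le.trans (Nat.add_le_add_left ht _)

theorem skip (x : Data) : RunWithin .skip x x 1 := ⟨1, le_rfl, .skip x⟩

theorem leaf (x : Data) : RunWithin .leaf x .leaf 1 := ⟨1, le_rfl, .leaf x⟩

theorem hd (x : Data) : RunWithin .hd x x.hd 1 := ⟨1, le_rfl, .hd x⟩

theorem tl (x : Data) : RunWithin .tl x x.tl 1 := ⟨1, le_rfl, .tl x⟩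

theorem pair (hp : RunWithin p x y S) (hq : RunWithin q x z T) :
    RunWithin (.pair p q) x (.node y z) (S + T + 1) :=
  let ⟨s, hs, hrun⟩ := hp
  let ⟨t, ht, hrun'⟩ := hq
  ⟨s + t + 1, by omega, .pair hrun hrun'⟩

theorem seq (hp : RunWithin p x y S) (hq : RunWithin q y z T) :
    RunWithin (.seq p q) x z (S + T + 1) :=
  let ⟨s, hs, hrun⟩ := hp
  let ⟨t, ht, hrun'⟩ := hq
  ⟨s + t + 1, by omega, .seq hrun hrun'⟩

theorem cond_node (hc : RunWithin c x (.node a b) S) (hp : RunWithin p x y T) :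
    RunWithin (.cond c p q) x y (S + T + 1) :=
  let ⟨s, hs, hrun⟩ := hc
  let ⟨t, ht, hrun'⟩ := hp
  ⟨s + t + 1, by omega, .cond_node hrun hrun'⟩

theorem cond_leaf (hc : RunWithin c x .leaf S) (hq : RunWithin q x y T) :
    RunWithin (.cond c p q) x y (S + T + 1) :=
  let ⟨s, hs, hrun⟩ := hc
  let ⟨t, ht, hrun'⟩ := hq
  ⟨s + t + 1, by omega, .cond_leaf hrun hrun'⟩

theorem loop_node (hc : RunWithin c x (.node a b) S) (hp : RunWithin p x y T)
    (hloop : RunWithin (.loop c p) y z U) : RunWithin (.loop c p) x z (S + T + U + 1) :=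
  let ⟨s, hs, hrun⟩ := hc
  let ⟨t, ht, hrun'⟩ := hp
  let ⟨u, hu, hrun''⟩ := hloop
  ⟨s + t + u + 1, by omega, .loop_node hrun hrun' hrun''⟩

theorem loop_leaf (hc : RunWithin c x .leaf S) : RunWithin (.loop c p) x x (S + 1) :=
  let ⟨s, hs, hrun⟩ := hc
  ⟨s + 1, by omega, .loop_leaf hrun⟩

end RunWithin

/-- The program which outputs the tree `d` on every input. -/
def constProg : Data → Prog
  | .leaf => .leaf
  | .node a b => .pair (constProg a) (constProg b)

theorem exists_runWithin_constProg (d : Data) : ∃ T, ∀ x, RunWithin (constProg d) x d T := by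
  induction d with
  | leaf => exact ⟨1, RunWithin.leaf⟩
  | node a b iha ihb =>
    obtain ⟨S, hS⟩ := iha
    obtain ⟨T, hT⟩ := ihb
    exact ⟨S + T + 1, fun x => (hS x).pair (hT x)⟩

/-- A way to write the elements of `α` as trees. It need not be injective. -/
class Enc (α : Type*) where
  enc : α → Data

open PinCSP.Enc (enc)

instance : Enc Unit := ⟨fun _ => .leaf⟩

instance : Enc Bool := ⟨encBool⟩

instance : Enc ℕ := ⟨encNat⟩

instance : Enc ℤ := ⟨encInt⟩

instance {α β : Type*} [Enc α] [Enc β] : Enc (α × β) := ⟨fun x => .node (enc x.1) (enc x.2)⟩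

instance {α : Type*} [Enc α] : Enc (List α) := ⟨fun l => encList (l.map enc)⟩

instance {α : Type*} [Enc α] {r : ℕ} : Enc (Fin r → α) :=
  ⟨fun f => encList (List.ofFn fun i => enc (f i))⟩

section Enc

variable {α β : Type*} [Enc α] [Enc β]

@[simp] theorem enc_unit (a : Unit) : enc a = Data.leaf := rfl

@[simp] theorem enc_true : enc true = Data.node .leaf .leaf := rfl

@[simp] theorem enc_false : enc false = Data.leaf := rfl

@[simp] theorem enc_mk (a : α) (b : β) : enc (a, b) = Data.node (enc a) (enc b) := rfl

theorem enc_prod (a : α × β) : enc a = Data.node (enc a.1) (enc a.2) := rfl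

@[simp] theorem enc_nil : enc ([] : List α) = Data.leaf := rfl

@[simp] theorem enc_cons (a : α) (l : List α) : enc (a :: l) = Data.node (enc a) (enc l) := rfl

theorem enc_fin_succ {r : ℕ} (f : Fin (r + 1) → α) :
    enc f = Data.node (enc (f 0)) (enc fun i : Fin r => f i.succ) := by
  change encList (List.ofFn fun i => enc (f i)) = _
  rw [List.ofFn_succ]
  rfl

theorem height_enc_bool_le (b : Bool) : (enc b).height ≤ 1 := by cases b <;> simp

theorem length_le_height_enc (l : List α) : l.length ≤ (enc l).height := by
  induction l with
  | nil => simp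
  | cons a l ih => simp only [enc_cons, Data.height_node, List.length_cons]; omega

theorem height_enc_le_of_mem {a : α} {l : List α} (h : a ∈ l) :
    (enc a).height ≤ (enc l).height := by
  induction l with
  | nil => simp at h
  | cons b l ih =>
    simp only [enc_cons, Data.height_node]
    rcases List.mem_cons.1 h with rfl | h
    · omega
    · have := ih h
      omega

theorem height_enc_list_le {l : List α} {m : ℕ} (h : ∀ a ∈ l, (enc a).height ≤ m) :
    (enc l).height ≤ l.length + m := by
  induction l with
  | nil => simp
  | cons b l ih =>
    have hb := h b List.mem_cons_self
    have hl := ih fun a ha => h a (List.mem_cons_of_mem b ha)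
    simp only [enc_cons, Data.height_node, List.length_cons]
    omega

theorem height_enc_append_le (l l' : List α) :
    (enc (l ++ l')).height ≤ (enc l).height + (enc l').height := by
  induction l with
  | nil => simp
  | cons a l ih => simp only [List.cons_append, enc_cons, Data.height_node]; omega

theorem height_enc_apply_le {r : ℕ} (f : Fin r → α) (j : Fin r) :
    (enc (f j)).height ≤ (enc f).height := by
  induction r with
  | zero => exact j.elim0
  | succ r ih =>
    rw [enc_fin_succ, Data.height_node]
    refine Fin.cases ?_ (fun j => ?_) j
    · omega
    · have := ih (fun i => f i.succ) j
      omega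

theorem height_enc_fin_le {r : ℕ} {f : Fin r → α} {m : ℕ} (h : ∀ j, (enc (f j)).height ≤ m) :
    (enc f).height ≤ r + m := by
  induction r with
  | zero => exact Nat.zero_le _
  | succ r ih =>
    have hzero := h 0
    have hsucc := ih fun j => h j.succ
    rw [enc_fin_succ, Data.height_node]
    omega

end Enc

/-! ### Uniform polynomial time -/

/-- A family, indexed by `ι`, of promises on inputs from `α`: the valid inputs, and a number of
steps granted on an input in addition to what its height allows. -/
structure Promise (ι α : Type*) where
  dom : ι → α → Prop
  budget : ι → α → ℕ

namespace Promise

variable {ι α : Type*}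

/-- The promise which admits every input and grants nothing. -/
def top (ι α : Type*) : Promise ι α := ⟨fun _ _ => True, fun _ _ => 0⟩

/-- The quantity in which running times are to be polynomial. -/
def size [Enc α] (Γ : Promise ι α) (i : ι) (x : α) : ℕ := Γ.budget i x + (enc x).height + 1

theorem one_le_size [Enc α] (Γ : Promise ι α) (i : ι) (x : α) : 1 ≤ Γ.size i x :=
  Nat.le_add_left _ _

end Promise

section PolyBounded

variable {ι α β : Type*} [Enc α] [Enc β] {Γ : Promise ι α} {m m' : ι → α → ℕ}

/-- On valid inputs the functions `m i` are bounded by polynomials in the size. The degree is the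
same for all `i`, whereas the constant factor may depend on `i`: this lets the parameters of a
reduction be chosen after the degree of its running time is known. -/
def PolyBounded (Γ : Promise ι α) (m : ι → α → ℕ) : Prop :=
  ∃ B : ℕ, ∀ i, ∃ k : ℕ, ∀ x, Γ.dom i x → m i x ≤ k * Γ.size i x ^ B

namespace PolyBounded

theorem mono (h : PolyBounded Γ m) (hm : ∀ i x, Γ.dom i x → m' i x ≤ m i x) :
    PolyBounded Γ m' := by
  obtain ⟨B, hB⟩ := h
  refine ⟨B, fun i => ?_⟩
  obtain ⟨k, hk⟩ := hB i
  exact ⟨k, fun x hx => (hm i x hx).trans (hk x hx)⟩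

theorem const (Γ : Promise ι α) (k : ι → ℕ) : PolyBounded Γ fun i _ => k i :=
  ⟨0, fun i => ⟨k i, fun x _ => by simp⟩⟩

theorem size (Γ : Promise ι α) : PolyBounded Γ Γ.size :=
  ⟨1, fun _ => ⟨1, fun x _ => by simp⟩⟩

theorem budget (Γ : Promise ι α) : PolyBounded Γ Γ.budget :=
  (size Γ).mono fun i x _ => by simp only [Promise.size]; omega

theorem height (Γ : Promise ι α) : PolyBounded Γ fun _ x => (enc x).height :=
  (size Γ).mono fun i x _ => by simp only [Promise.size]; omega

theorem add (h : PolyBounded Γ m) (h' : PolyBounded Γ m') :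
    PolyBounded Γ fun i x => m i x + m' i x := by
  obtain ⟨B, hB⟩ := h
  obtain ⟨B', hB'⟩ := h'
  refine ⟨B + B', fun i => ?_⟩
  obtain ⟨k, hk⟩ := hB i
  obtain ⟨k', hk'⟩ := hB' i
  refine ⟨k + k', fun x hx => ?_⟩
  have hsize := Γ.one_le_size i x
  calc m i x + m' i x ≤ k * Γ.size i x ^ B + k' * Γ.size i x ^ B' :=
        add_le_add (hk x hx) (hk' x hx)
    _ ≤ k * Γ.size i x ^ (B + B') + k' * Γ.size i x ^ (B + B') := by gcongr <;> omega
    _ = _ := (add_mul ..).symm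

theorem mul (h : PolyBounded Γ m) (h' : PolyBounded Γ m') :
    PolyBounded Γ fun i x => m i x * m' i x := by
  obtain ⟨B, hB⟩ := h
  obtain ⟨B', hB'⟩ := h'
  refine ⟨B + B', fun i => ?_⟩
  obtain ⟨k, hk⟩ := hB i
  obtain ⟨k', hk'⟩ := hB' i
  refine ⟨k * k', fun x hx => ?_⟩
  calc m i x * m' i x ≤ (k * Γ.size i x ^ B) * (k' * Γ.size i x ^ B') :=
        Nat.mul_le_mul (hk x hx) (hk' x hx)
    _ = _ := by ring

theorem pow (h : PolyBounded Γ m) (n : ℕ) : PolyBounded Γ fun i x => m i x ^ n := by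
  induction n with
  | zero => exact (const Γ fun _ => 1).mono fun i x _ => by simp
  | succ n ih => exact (ih.mul h).mono fun i x _ => by rw [pow_succ]

theorem add_const (h : PolyBounded Γ m) (k : ι → ℕ) : PolyBounded Γ fun i x => m i x + k i :=
  h.add (const Γ k)

theorem comp {Δ : Promise ι β} {m : ι → β → ℕ} {f : ι → α → β} (h : PolyBounded Δ m)
    (hdom : ∀ i x, Γ.dom i x → Δ.dom i (f i x))
    (hbudget : PolyBounded Γ fun i x => Δ.budget i (f i x))
    (hheight : PolyBounded Γ fun i x => (enc (f i x)).height) :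
    PolyBounded Γ fun i x => m i (f i x) := by
  obtain ⟨B, hB⟩ := h
  choose k hk using hB
  exact ((const Γ k).mul (((hbudget.add hheight).add_const fun _ => 1).pow B)).mono
    fun i x hx => hk i _ (hdom i x hx)

end PolyBounded

end PolyBounded

section PolyTime

variable {ι α β γ σ : Type*} [Enc α] [Enc β] [Enc γ] [Enc σ] {Γ : Promise ι α}

/-- On valid inputs the functions `f i` are computed by programs in polynomial time, with a degree
that does not depend on `i`. -/
def PolyTime (Γ : Promise ι α) (f : ι → α → β) : Prop :=
  ∃ (p : ι → Prog) (m : ι → α → ℕ), PolyBounded Γ m ∧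
    ∀ i x, Γ.dom i x → RunWithin (p i) (enc x) (enc (f i x)) (m i x)

namespace PolyTime

theorem of_prog {f : ι → α → β} (p : Prog) (T : ℕ)
    (h : ∀ i x, Γ.dom i x → RunWithin p (enc x) (enc (f i x)) T) : PolyTime Γ f :=
  ⟨fun _ => p, fun _ _ => T, PolyBounded.const Γ _, h⟩

theorem congr_enc {f : ι → α → β} {g : ι → α → γ} (hf : PolyTime Γ f)
    (h : ∀ i x, Γ.dom i x → enc (f i x) = enc (g i x)) : PolyTime Γ g := by
  obtain ⟨p, m, hm, hp⟩ := hf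
  exact ⟨p, m, hm, fun i x hx => h i x hx ▸ hp i x hx⟩

theorem congr {f g : ι → α → β} (hf : PolyTime Γ f)
    (h : ∀ i x, Γ.dom i x → f i x = g i x) : PolyTime Γ g :=
  hf.congr_enc fun i x hx => by rw [h i x hx]

theorem height {f : ι → α → β} (hf : PolyTime Γ f) :
    PolyBounded Γ fun i x => (enc (f i x)).height := by
  obtain ⟨p, m, hm, hp⟩ := hf
  exact ((PolyBounded.height Γ).add hm).mono fun i x hx => (hp i x hx).height_le

theorem id (Γ : Promise ι α) : PolyTime Γ fun _ x => x :=
  of_prog .skip 1 fun _ x _ => RunWithin.skip (enc x)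

theorem const (Γ : Promise ι α) (b : ι → β) : PolyTime Γ fun i _ => b i := by
  choose T hT using exists_runWithin_constProg
  exact ⟨fun i => constProg (enc (b i)), fun i _ => T (enc (b i)), PolyBounded.const Γ _,
    fun i x _ => hT _ _⟩

theorem comp_of_dom {Δ : Promise ι β} {f : ι → α → β} {g : ι → β → γ} (hg : PolyTime Δ g)
    (hf : PolyTime Γ f) (hdom : ∀ i x, Γ.dom i x → Δ.dom i (f i x))
    (hbudget : PolyBounded Γ fun i x => Δ.budget i (f i x)) :
    PolyTime Γ fun i x => g i (f i x) := by
  have hheight := hf.height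
  obtain ⟨p, m, hm, hp⟩ := hf
  obtain ⟨q, m', hm', hq⟩ := hg
  exact ⟨fun i => .seq (p i) (q i), fun i x => m i x + m' i (f i x) + 1,
    (hm.add (hm'.comp hdom hbudget hheight)).add_const fun _ => 1,
    fun i x hx => (hp i x hx).seq (hq i _ (hdom i x hx))⟩

theorem comp {f : ι → α → β} {g : ι → β → γ} (hg : PolyTime (Promise.top ι β) g)
    (hf : PolyTime Γ f) : PolyTime Γ fun i x => g i (f i x) :=
  comp_of_dom hg hf (fun _ _ _ => trivial) (PolyBounded.const Γ fun _ => 0)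

theorem of_top {f : ι → α → β} (hf : PolyTime (Promise.top ι α) f) : PolyTime Γ f :=
  hf.comp (id Γ)

theorem pair {f : ι → α → β} {g : ι → α → γ} (hf : PolyTime Γ f) (hg : PolyTime Γ g) :
    PolyTime Γ fun i x => (f i x, g i x) := by
  obtain ⟨p, m, hm, hp⟩ := hf
  obtain ⟨q, m', hm', hq⟩ := hg
  exact ⟨fun i => .pair (p i) (q i), fun i x => m i x + m' i x + 1,
    (hm.add hm').add_const fun _ => 1, fun i x hx => (hp i x hx).pair (hq i x hx)⟩

theorem comp₂ {f : ι → α → β} {g : ι → α → γ} {h : ι → β → γ → σ}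
    (hh : PolyTime (Promise.top ι (β × γ)) fun i x => h i x.1 x.2)
    (hf : PolyTime Γ f) (hg : PolyTime Γ g) : PolyTime Γ fun i x => h i (f i x) (g i x) :=
  hh.comp (hf.pair hg)

theorem fst {f : ι → α → β × γ} (hf : PolyTime Γ f) : PolyTime Γ fun i x => (f i x).1 :=
  comp (g := fun _ (y : β × γ) => y.1) (of_prog .hd 1 fun _ x _ => RunWithin.hd (enc x)) hf

theorem snd {f : ι → α → β × γ} (hf : PolyTime Γ f) : PolyTime Γ fun i x => (f i x).2 :=
  comp (g := fun _ (y : β × γ) => y.2) (of_prog .tl 1 fun _ x _ => RunWithin.tl (enc x)) hf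

theorem ite {c : ι → α → Bool} {f g : ι → α → β} (hc : PolyTime Γ c) (hf : PolyTime Γ f)
    (hg : PolyTime Γ g) : PolyTime Γ fun i x => if c i x then f i x else g i x := by
  obtain ⟨pc, mc, hmc, hpc⟩ := hc
  obtain ⟨p, m, hm, hp⟩ := hf
  obtain ⟨q, m', hm', hq⟩ := hg
  refine ⟨fun i => .cond (pc i) (p i) (q i), fun i x => mc i x + (m i x + m' i x) + 1,
    (hmc.add (hm.add hm')).add_const fun _ => 1, fun i x hx => ?_⟩
  have htest := hpc i x hx
  dsimp only
  cases h : c i x <;> rw [h] at htest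
  · exact (htest.cond_leaf (hq i x hx)).mono (by omega)
  · exact (htest.cond_node (hp i x hx)).mono (by omega)

theorem cons {f : ι → α → β} {g : ι → α → List β} (hf : PolyTime Γ f) (hg : PolyTime Γ g) :
    PolyTime Γ fun i x => f i x :: g i x :=
  (hf.pair hg).congr_enc fun _ _ _ => rfl

theorem tail {f : ι → α → List β} (hf : PolyTime Γ f) : PolyTime Γ fun i x => (f i x).tail :=
  comp (g := fun _ (y : List β) => y.tail)
    (of_prog .tl 1 fun _ x _ => by cases x <;> exact RunWithin.tl _) hf

theorem isEmpty {f : ι → α → List β} (hf : PolyTime Γ f) :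
    PolyTime Γ fun i x => (f i x).isEmpty :=
  comp (g := fun _ (y : List β) => y.isEmpty)
    (of_prog (.cond .skip .leaf (.pair .leaf .leaf)) 5 fun _ x _ => by
      cases x
      · exact (RunWithin.skip _).cond_leaf ((RunWithin.leaf _).pair (RunWithin.leaf _))
      · exact ((RunWithin.skip _).cond_node (RunWithin.leaf _)).mono (by omega)) hf

theorem not {f : ι → α → Bool} (hf : PolyTime Γ f) : PolyTime Γ fun i x => !(f i x) :=
  (hf.ite (const Γ fun _ => false) (const Γ fun _ => true)).congr fun i x _ => by
    cases f i x <;> rfl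

theorem and {f g : ι → α → Bool} (hf : PolyTime Γ f) (hg : PolyTime Γ g) :
    PolyTime Γ fun i x => f i x && g i x :=
  (hf.ite hg (const Γ fun _ => false)).congr fun i x _ => by cases f i x <;> rfl

theorem or {f g : ι → α → Bool} (hf : PolyTime Γ f) (hg : PolyTime Γ g) :
    PolyTime Γ fun i x => f i x || g i x :=
  (hf.ite (const Γ fun _ => true) hg).congr fun i x _ => by cases f i x <;> rfl

theorem xor {f g : ι → α → Bool} (hf : PolyTime Γ f) (hg : PolyTime Γ g) :
    PolyTime Γ fun i x => Bool.xor (f i x) (g i x) :=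
  (hf.ite hg.not hg).congr fun i x _ => by cases f i x <;> simp

theorem tuple {r : ℕ} {f : ι → α → Fin r → β} (h : ∀ j, PolyTime Γ fun i x => f i x j) :
    PolyTime Γ f := by
  induction r with
  | zero => exact (const Γ fun _ => ()).congr_enc fun i x _ =>
      (congrArg encList (List.ofFn_zero (f := fun j => enc (f i x j)))).symm
  | succ r ih =>
    exact ((h 0).pair (ih (f := fun i x j => f i x j.succ) fun j => h j.succ)).congr_enc
      fun i x _ => (enc_fin_succ (f i x)).symm

theorem apply {r : ℕ} {f : ι → α → Fin r → β} (hf : PolyTime Γ f) (j : Fin r) :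
    PolyTime Γ fun i x => f i x j := by
  induction r with
  | zero => exact j.elim0
  | succ r ih =>
    have hhead : PolyTime Γ fun i x => f i x 0 :=
      comp (g := fun _ (y : Fin (r + 1) → β) => y 0)
        (of_prog .hd 1 fun _ y _ => enc_fin_succ y ▸ RunWithin.hd _) hf
    have htail : PolyTime Γ fun i x (j : Fin r) => f i x j.succ :=
      comp (g := fun _ (y : Fin (r + 1) → β) (j : Fin r) => y j.succ)
        (of_prog .tl 1 fun _ y _ => enc_fin_succ y ▸ RunWithin.tl _) hf
    exact Fin.cases hhead (fun j => ih htail j) j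

end PolyTime

end PolyTime

/-! ### Folds -/

section Fold

variable {ι α β γ σ : Type*} [Enc α] [Enc β] [Enc γ] [Enc σ]

/-- The promise for the step of a fold over the list `l`, whose input consists of the input of the
fold, the accumulator and an element of the list. -/
def Promise.fold (Γ : Promise ι α) (l : ι → α → List β) (σ : Type*) : Promise ι (α × σ × β) :=
  ⟨fun i y => Γ.dom i y.1 ∧ y.2.2 ∈ l i y.1, fun i y => Γ.budget i y.1⟩

/-- The promise for a function which is applied to every element of the list `l`. -/
def Promise.elem (Γ : Promise ι α) (l : ι → α → List β) : Promise ι (α × β) :=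
  ⟨fun i y => Γ.dom i y.1 ∧ y.2 ∈ l i y.1, fun i y => Γ.budget i y.1⟩

theorem PolyBounded.exists_of_size_le {Γ : Promise ι α} {Δ : Promise ι β} {m : ι → β → ℕ}
    {N : ι → α → ℕ} (hm : PolyBounded Δ m) (hN : PolyBounded Γ N) :
    ∃ T, PolyBounded Γ T ∧ ∀ i x y, Δ.dom i y → Δ.size i y ≤ N i x → m i y ≤ T i x := by
  obtain ⟨B, hB⟩ := hm
  choose k hk using hB
  exact ⟨_, (PolyBounded.const Γ k).mul (hN.pow B), fun i x y hy hsize =>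
    (hk i y hy).trans (Nat.mul_le_mul_left _ (Nat.pow_le_pow_left hsize B))⟩

/-- The loop which folds over a list with step `p`. Its state consists of the remaining list, the
input and the accumulator. -/
def foldLoop (p : Prog) : Prog :=
  .loop .hd (.pair (.seq .hd .tl) (.pair (.seq .tl .hd)
    (.seq (.pair (.seq .tl .hd) (.pair (.seq .tl .tl) (.seq .hd .hd))) p)))

theorem runWithin_foldLoop_body {p : Prog} {x : α} {b : β} {l : List β} {s s' : σ} {T : ℕ}
    (hp : RunWithin p (enc (x, s, b)) (enc s') T) :
    RunWithin (.pair (.seq .hd .tl) (.pair (.seq .tl .hd)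
        (.seq (.pair (.seq .tl .hd) (.pair (.seq .tl .tl) (.seq .hd .hd))) p)))
      (enc (b :: l, x, s)) (enc (l, x, s')) (T + 21) := by
  have hinput : RunWithin (.pair (.seq .tl .hd) (.pair (.seq .tl .tl) (.seq .hd .hd)))
      (enc (b :: l, x, s)) (enc (x, s, b)) 11 :=
    ((RunWithin.tl _).seq (RunWithin.hd _)).pair
      (((RunWithin.tl _).seq (RunWithin.tl _)).pair ((RunWithin.hd _).seq (RunWithin.hd _)))
  exact (((RunWithin.hd _).seq (RunWithin.tl _)).pair
    (((RunWithin.tl _).seq (RunWithin.hd _)).pair (hinput.seq hp))).mono (by omega)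

theorem runWithin_foldLoop {p : Prog} {x : α} {h : σ → β → σ} {T : ℕ} (l : List β) (s : σ)
    (hp : ∀ pre b suf, l = pre ++ b :: suf →
      RunWithin p (enc (x, pre.foldl h s, b)) (enc ((pre ++ [b]).foldl h s)) T) :
    RunWithin (foldLoop p) (enc (l, x, s)) (enc (([] : List β), x, l.foldl h s))
      (l.length * (T + 23) + 2) := by
  induction l generalizing s with
  | nil => exact (RunWithin.loop_leaf (RunWithin.hd _)).mono (by simp)
  | cons b l ih =>
    have hbody := runWithin_foldLoop_body (l := l) (hp [] b l rfl)
    have hrest := ih (h s b) fun pre c suf hl => by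
      simpa using hp (b :: pre) c suf (by simp [hl])
    refine (RunWithin.loop_node (RunWithin.hd _) hbody hrest).mono ?_
    rw [List.length_cons, add_mul]
    omega

omit [Enc β] in
theorem height_enc_foldl_le {h : σ → β → σ} {B : ℕ} (l : List β) (s : σ)
    (hB : ∀ s, ∀ b ∈ l, (enc (h s b)).height ≤ (enc s).height + B) :
    (enc (l.foldl h s)).height ≤ (enc s).height + l.length * B := by
  induction l generalizing s with
  | nil => simp
  | cons b l ih =>
    have hrest := ih (h s b) fun s c hc => hB s c (List.mem_cons_of_mem b hc)
    have hstep := hB s b List.mem_cons_self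
    simp only [List.foldl_cons, List.length_cons, add_mul, one_mul]
    omega

namespace PolyTime

variable {Γ : Promise ι α}

theorem foldl {l : ι → α → List β} {g : ι → α → σ} {h : ι → α × σ × β → σ}
    (hl : PolyTime Γ l) (hg : PolyTime Γ g) (hh : PolyTime (Γ.fold l σ) h)
    {B : ι → α → ℕ} (hB : PolyBounded Γ B)
    (hacc : ∀ i x, Γ.dom i x → ∀ pre suf, l i x = pre ++ suf →
      (enc (pre.foldl (fun s b => h i (x, s, b)) (g i x))).height ≤ B i x) :
    PolyTime Γ fun i x => (l i x).foldl (fun s b => h i (x, s, b)) (g i x) := by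
  have hlheight := hl.height
  obtain ⟨pl, ml, hml, hpl⟩ := hl
  obtain ⟨pg, mg, hmg, hpg⟩ := hg
  obtain ⟨ph, mh, hmh, hph⟩ := hh
  obtain ⟨T, hT, hmT⟩ := hmh.exists_of_size_le
    (((PolyBounded.size Γ).add (hB.add hlheight)).add_const fun _ => 2)
  have hstep : ∀ i x, Γ.dom i x → ∀ pre b suf, l i x = pre ++ b :: suf →
      RunWithin (ph i) (enc (x, pre.foldl (fun s b => h i (x, s, b)) (g i x), b))
        (enc ((pre ++ [b]).foldl (fun s b => h i (x, s, b)) (g i x))) (T i x) := by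
    intro i x hx pre b suf hsplit
    have hmem : b ∈ l i x := by simp [hsplit]
    have hrun := hph i (x, pre.foldl (fun s b => h i (x, s, b)) (g i x), b) ⟨hx, hmem⟩
    rw [List.foldl_append, List.foldl_cons, List.foldl_nil]
    refine hrun.mono (hmT i x _ ⟨hx, hmem⟩ ?_)
    have hpre := hacc i x hx pre (b :: suf) hsplit
    have hb := height_enc_le_of_mem hmem
    simp only [Promise.size, Promise.fold, enc_mk, Data.height_node]
    omega
  refine ⟨fun i => .seq (.seq (.pair (pl i) (.pair .skip (pg i))) (foldLoop (ph i)))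
      (.seq .tl .tl), fun i x => ml i x + mg i x + (enc (l i x)).height * (T i x + 23) + 10,
    ((hml.add hmg).add (hlheight.mul (hT.add_const fun _ => 23))).add_const fun _ => 10,
    fun i x hx => ?_⟩
  have hlength := Nat.mul_le_mul_right (T i x + 23) (length_le_height_enc (l i x))
  have hinit := (hpl i x hx).pair ((RunWithin.skip _).pair (hpg i x hx))
  have hloop := runWithin_foldLoop (l i x) (g i x) (hstep i x hx)
  exact ((hinit.seq hloop).seq ((RunWithin.tl _).seq (RunWithin.tl _))).mono
    (by dsimp only; omega)

theorem foldl_of_height_step_le {l : ι → α → List β} {g : ι → α → σ} {h : ι → α × σ × β → σ}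
    (hl : PolyTime Γ l) (hg : PolyTime Γ g) (hh : PolyTime (Γ.fold l σ) h)
    {B : ι → α → ℕ} (hB : PolyBounded Γ B)
    (hstep : ∀ i x s b, Γ.dom i x → b ∈ l i x →
      (enc (h i (x, s, b))).height ≤ (enc s).height + B i x) :
    PolyTime Γ fun i x => (l i x).foldl (fun s b => h i (x, s, b)) (g i x) := by
  refine foldl hl hg hh (hg.height.add (hl.height.mul hB)) fun i x hx pre suf hsplit => ?_
  have hlength : pre.length ≤ (enc (l i x)).height :=
    le_trans (by simp [hsplit]) (length_le_height_enc (l i x))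
  calc _ ≤ (enc (g i x)).height + pre.length * B i x :=
        height_enc_foldl_le pre _ fun s b hb => hstep i x s b hx (by simp [hsplit, hb])
    _ ≤ _ := by gcongr

theorem foldl_cons {l : ι → α → List β} {g : ι → α → List γ} {f : ι → α × β → γ}
    (hl : PolyTime Γ l) (hg : PolyTime Γ g) (hf : PolyTime (Γ.elem l) f) :
    PolyTime Γ fun i x => (l i x).foldl (fun s b => f i (x, b) :: s) (g i x) := by
  obtain ⟨B, hB, hfB⟩ := hf.height.exists_of_size_le
    (((PolyBounded.size Γ).add hl.height).add_const fun _ => 1)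
  have hf' : PolyTime (Γ.fold l (List γ)) fun i y => f i (y.1, y.2.2) :=
    comp_of_dom hf ((id _).fst.pair (id _).snd.snd) (fun _ _ hy => hy) (PolyBounded.budget _)
  refine foldl_of_height_step_le hl hg (hf'.cons (id _).snd.fst) (hB.add_const fun _ => 1)
    fun i x s b hx hb => ?_
  have hsize : (Γ.elem l).size i (x, b) ≤ Γ.size i x + (enc (l i x)).height + 1 := by
    have := height_enc_le_of_mem hb
    simp only [Promise.size, Promise.elem, enc_mk, Data.height_node]
    omega
  have := hfB i x (x, b) ⟨hx, hb⟩ hsize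
  simp only [enc_cons, Data.height_node]
  omega

theorem reverse {f : ι → α → List β} (hf : PolyTime Γ f) :
    PolyTime Γ fun i x => (f i x).reverse :=
  (foldl_cons hf (const Γ fun _ => []) (f := fun _ y => y.2) (id _).snd).congr fun i x _ => by
    simp [List.foldl_flip_cons_eq_append (f := fun b : β => b)]

theorem append {f g : ι → α → List β} (hf : PolyTime Γ f) (hg : PolyTime Γ g) :
    PolyTime Γ fun i x => f i x ++ g i x :=
  (foldl_cons hf.reverse hg (f := fun _ y => y.2) (id _).snd).congr fun i x _ => by
    simp [List.foldl_flip_cons_eq_append (f := fun b : β => b)]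

theorem map {l : ι → α → List β} {f : ι → α × β → γ} (hl : PolyTime Γ l)
    (hf : PolyTime (Γ.elem l) f) : PolyTime Γ fun i x => (l i x).map fun b => f i (x, b) :=
  (foldl_cons hl (const Γ fun _ => []) hf).reverse.congr fun i x _ => by
    simp [List.foldl_flip_cons_eq_append]

theorem filter {l : ι → α → List β} {f : ι → α × β → Bool} (hl : PolyTime Γ l)
    (hf : PolyTime (Γ.elem l) f) :
    PolyTime Γ fun i x => (l i x).filter fun b => f i (x, b) := by
  have hcons : PolyTime (Γ.fold l (List β)) fun i y =>
      if f i (y.1, y.2.2) then y.2.2 :: y.2.1 else y.2.1 :=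
    ite (c := fun i (y : α × List β × β) => f i (y.1, y.2.2))
      (comp_of_dom hf ((id _).fst.pair (id _).snd.snd) (fun _ _ hy => hy) (PolyBounded.budget _))
      ((id _).snd.snd.cons (id _).snd.fst) (id _).snd.fst
  refine (foldl_of_height_step_le hl (const Γ fun _ => []) hcons (hl.height.add_const fun _ => 1)
    fun _ _ _ _ _ hb => ?_).reverse.congr fun i x _ => ?_
  · have := height_enc_le_of_mem hb
    dsimp only
    split_ifs
    · simp only [enc_cons, Data.height_node]
      omega
    · omega
  · rw [← List.foldl_filter (p := fun b => f i (x, b)) (f := fun (s : List β) b => b :: s)]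
    simp [List.foldl_flip_cons_eq_append (f := fun b : β => b)]

theorem any {l : ι → α → List β} {f : ι → α × β → Bool} (hl : PolyTime Γ l)
    (hf : PolyTime (Γ.elem l) f) :
    PolyTime Γ fun i x => (l i x).any fun b => f i (x, b) :=
  (hl.filter hf).isEmpty.not.congr fun i x _ => by
    rw [Bool.eq_iff_iff]
    simp

end PolyTime

end Fold

/-! ### Unary arithmetic -/

/-- A natural number which is to be written in unary. -/
structure Unary where
  val : ℕ

instance : Enc Unary := ⟨fun n => encUnary n.val⟩

theorem enc_unary (n : Unary) : enc n = enc (List.replicate n.val ()) := by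
  change encUnary _ = encList _
  rw [List.map_replicate]
  rfl

@[simp] theorem height_enc_unary (n : Unary) : (enc n).height = n.val := by
  rw [enc_unary]
  induction n.val with
  | zero => rfl
  | succ k ih => simp [List.replicate_succ, ih]

theorem iterate_pred (n : ℕ) (s : Unary) :
    (List.replicate n ()).foldl (fun s _ => Unary.mk (s.val - 1)) s = ⟨s.val - n⟩ := by
  induction n generalizing s with
  | zero => simp
  | succ n ih => rw [List.replicate_succ, List.foldl_cons, ih, Nat.sub_sub, Nat.add_comm]

/-- One step of unary division by `d`, on the pair of the current remainder and quotient. -/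
def divStep (d : ℕ) (s : Unary × Unary) : Unary × Unary :=
  if decide (s.1.val + 1 = d) then (⟨0⟩, ⟨s.2.val + 1⟩) else (⟨s.1.val + 1⟩, s.2)

theorem divStep_mod_div {d : ℕ} (hd : 0 < d) (n : ℕ) :
    divStep d (⟨n % d⟩, ⟨n / d⟩) = (⟨(n + 1) % d⟩, ⟨(n + 1) / d⟩) := by
  have hdecomp := Nat.div_add_mod n d
  have hlt := Nat.mod_lt n hd
  simp only [divStep, decide_eq_true_eq]
  split_ifs with hcarry
  · have := (Nat.div_mod_unique hd (a := n + 1) (c := 0) (d := n / d + 1)).2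
      ⟨by rw [mul_add]; omega, hd⟩
    rw [this.1, this.2]
  · have := (Nat.div_mod_unique hd (a := n + 1) (c := n % d + 1) (d := n / d)).2
      ⟨by omega, by omega⟩
    rw [this.1, this.2]

theorem iterate_divStep {d : ℕ} (hd : 0 < d) (n : ℕ) :
    (List.replicate n ()).foldl (fun s _ => divStep d s) (⟨0⟩, ⟨0⟩) = (⟨n % d⟩, ⟨n / d⟩) := by
  induction n with
  | zero => simp
  | succ n ih =>
    rw [List.replicate_succ', List.foldl_append, ih, List.foldl_cons, List.foldl_nil,
      divStep_mod_div hd]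

theorem iterate_count (n : ℕ) :
    (List.replicate n ()).foldl
      (fun (s : Unary × List Unary) _ => (⟨s.1.val + 1⟩, s.1 :: s.2)) (⟨0⟩, []) =
      (⟨n⟩, ((List.range n).map Unary.mk).reverse) := by
  induction n with
  | zero => simp
  | succ n ih =>
    rw [List.replicate_succ', List.foldl_append, ih]
    simp [List.range_succ]

namespace PolyTime

variable {ι α : Type*} [Enc α] {Γ : Promise ι α}

theorem replicate_unit {f : ι → α → Unary} (hf : PolyTime Γ f) :
    PolyTime Γ fun i x => List.replicate (f i x).val () :=
  hf.congr_enc fun _ _ _ => enc_unary _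

theorem length_unit {f : ι → α → List Unit} (hf : PolyTime Γ f) :
    PolyTime Γ fun i x => Unary.mk (f i x).length :=
  hf.congr_enc fun i x _ => by
    rw [enc_unary]
    congr 1
    exact List.eq_replicate_of_mem fun _ _ => rfl

theorem unary_succ {f : ι → α → Unary} (hf : PolyTime Γ f) :
    PolyTime Γ fun i x => Unary.mk ((f i x).val + 1) :=
  ((const Γ fun _ => ()).pair hf).congr_enc fun _ _ _ => rfl

theorem unary_pred {f : ι → α → Unary} (hf : PolyTime Γ f) :
    PolyTime Γ fun i x => Unary.mk ((f i x).val - 1) :=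
  hf.replicate_unit.tail.length_unit.congr fun i x _ => by simp

theorem unary_eq_zero {f : ι → α → Unary} (hf : PolyTime Γ f) :
    PolyTime Γ fun i x => decide ((f i x).val = 0) :=
  hf.replicate_unit.isEmpty.congr fun i x _ => by simp

theorem unary_add {f g : ι → α → Unary} (hf : PolyTime Γ f) (hg : PolyTime Γ g) :
    PolyTime Γ fun i x => Unary.mk ((f i x).val + (g i x).val) :=
  (hf.replicate_unit.append hg.replicate_unit).length_unit.congr fun i x _ => by simp

theorem unary_sub {f g : ι → α → Unary} (hf : PolyTime Γ f) (hg : PolyTime Γ g) :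
    PolyTime Γ fun i x => Unary.mk ((f i x).val - (g i x).val) :=
  (foldl_of_height_step_le (h := fun _ y => Unary.mk (y.2.1.val - 1)) hg.replicate_unit hf
    (id _).snd.fst.unary_pred (PolyBounded.const Γ fun _ => 0)
    fun _ _ _ _ _ _ => by simp).congr fun i x _ => iterate_pred _ _

theorem unary_eq {f g : ι → α → Unary} (hf : PolyTime Γ f) (hg : PolyTime Γ g) :
    PolyTime Γ fun i x => decide ((f i x).val = (g i x).val) :=
  ((hf.unary_sub hg).unary_eq_zero.and (hg.unary_sub hf).unary_eq_zero).congr fun i x _ => by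
    rw [Bool.eq_iff_iff]
    simp only [Bool.and_eq_true, decide_eq_true_eq]
    omega

theorem unary_div {f : ι → α → Unary} (hf : PolyTime Γ f) (d : ι → ℕ) (hd : ∀ i, 0 < d i) :
    PolyTime Γ fun i x => Unary.mk ((f i x).val / d i) := by
  have hstep : PolyTime (Γ.fold (fun i x => List.replicate (f i x).val ()) (Unary × Unary))
      fun i y => divStep (d i) y.2.1 :=
    ite (unary_eq (id _).snd.fst.fst.unary_succ (const _ fun i => Unary.mk (d i)))
      ((const _ fun _ => Unary.mk 0).pair (id _).snd.fst.snd.unary_succ)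
      ((id _).snd.fst.fst.unary_succ.pair (id _).snd.fst.snd)
  have hfold := foldl_of_height_step_le hf.replicate_unit
    (const Γ fun _ => (Unary.mk 0, Unary.mk 0)) hstep (PolyBounded.const Γ fun _ => 1)
    fun _ _ s _ _ _ => by
      rw [enc_prod s, divStep]
      split_ifs <;> simp only [enc_mk, Data.height_node, height_enc_unary] <;> omega
  exact hfold.snd.congr fun i x _ => by rw [iterate_divStep (hd i)]

theorem unary_range {f : ι → α → Unary} (hf : PolyTime Γ f) :
    PolyTime Γ fun i x => (List.range (f i x).val).map Unary.mk := by
  have hfold := foldl_of_height_step_le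
    (h := fun _ y => (Unary.mk (y.2.1.1.val + 1), y.2.1.1 :: y.2.1.2)) hf.replicate_unit
    (const Γ fun _ => (Unary.mk 0, [])) ((id _).snd.fst.fst.unary_succ.pair
      ((id _).snd.fst.fst.cons (id _).snd.fst.snd)) (PolyBounded.const Γ fun _ => 1)
    fun _ _ s _ _ _ => by
      dsimp only
      rw [enc_prod s]
      simp
  exact hfold.snd.reverse.congr fun i x _ => by rw [iterate_count, List.reverse_reverse]

end PolyTime

/-! ### Binary arithmetic -/

theorem enc_nat (n : ℕ) : enc n = enc n.bits := rfl

theorem enc_nat_bit (b : Bool) (n : ℕ) :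
    enc (Nat.bit b n) = enc (if b || !n.bits.isEmpty then b :: n.bits else []) := by
  rw [enc_nat]
  rcases eq_or_ne n 0 with rfl | hn
  · cases b <;> simp
  · rw [Nat.bits_append_bit n b fun h => absurd h hn]
    have hbits : n.bits ≠ [] := by
      rw [← List.length_pos_iff, Nat.size_eq_bits_len]
      exact Nat.size_pos.2 (Nat.pos_of_ne_zero hn)
    simp [hbits]

theorem lt_two_pow_height_enc (n : ℕ) : n < 2 ^ (enc n).height := by
  rw [← Nat.size_le, ← Nat.size_eq_bits_len, enc_nat]
  exact length_le_height_enc _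

theorem height_enc_nat_le {n k : ℕ} (h : n < 2 ^ k) : (enc n).height ≤ k + 1 := by
  have hsize := Nat.size_le.2 h
  have hlist := height_enc_list_le (l := n.bits) fun b _ => height_enc_bool_le b
  rw [Nat.size_eq_bits_len] at hlist
  exact hlist.trans (Nat.succ_le_succ hsize)

theorem height_enc_tail_le {α : Type*} [Enc α] (l : List α) :
    (enc l.tail).height ≤ (enc l).height := by
  cases l
  · exact le_rfl
  · simp only [List.tail_cons, enc_cons, Data.height_node]
    omega

theorem enc_int (z : ℤ) : enc z = enc (decide (z < 0), z.natAbs) := rfl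

theorem natAbs_lt_two_pow_height_enc (z : ℤ) : z.natAbs < 2 ^ (enc z).height := by
  refine (lt_two_pow_height_enc z.natAbs).trans_le (Nat.pow_le_pow_right two_pos ?_)
  rw [enc_int, enc_mk, Data.height_node]
  omega

theorem height_enc_int_le {z : ℤ} {k : ℕ} (h : z.natAbs < 2 ^ k) : (enc z).height ≤ k + 2 := by
  have hsign := height_enc_bool_le (decide (z < 0))
  have habs := height_enc_nat_le h
  rw [enc_int, enc_mk, Data.height_node]
  omega

/-- The number with the given binary digits, most significant digit first. -/
def msbVal : List Bool → ℕ
  | [] => 0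
  | b :: l => b.toNat * 2 ^ l.length + msbVal l

theorem msbVal_lt (l : List Bool) : msbVal l < 2 ^ l.length := by
  induction l with
  | nil => simp [msbVal]
  | cons b l ih => cases b <;> simp [msbVal, pow_succ] <;> omega

theorem foldl_bit (l : List Bool) (n : ℕ) :
    l.foldl (fun n b => Nat.bit b n) n = n * 2 ^ l.length + msbVal l := by
  induction l generalizing n with
  | nil => simp [msbVal]
  | cons b l ih =>
    rw [List.foldl_cons, ih]
    cases b <;> simp [msbVal, Nat.bit_val, pow_succ] <;> ring

/-- The state of the schoolbook addition or subtraction of two binary numbers: the digits that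
remain of the two numbers, the carry, and the digits of the result found so far. -/
abbrev CarryState := (ℕ × ℕ) × Bool × List Bool

/-- One step of the schoolbook addition (or subtraction, if `neg`). -/
def carryStep (neg : Bool) (s : CarryState) : CarryState :=
  ((s.1.1.div2, s.1.2.div2),
    ((Bool.xor s.1.1.bodd neg && (s.1.2.bodd || s.2.1)) || (s.1.2.bodd && s.2.1),
      (Bool.xor s.1.1.bodd (Bool.xor s.1.2.bodd s.2.1)) :: s.2.2))

/-- The result of the addition (or subtraction, if `neg`) which the state `s` leads to. -/
def carryValue (neg : Bool) (s : CarryState) : ℤ :=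
  msbVal s.2.2 + 2 ^ s.2.2.length * (s.1.1 + (if neg then -1 else 1) * (s.1.2 + s.2.1.toNat))

theorem carryValue_carryStep (neg : Bool) (s : CarryState) :
    carryValue neg (carryStep neg s) = carryValue neg s := by
  obtain ⟨⟨a, b⟩, c, l⟩ := s
  have ha : (a : ℤ) = a.bodd.toNat + 2 * a.div2 := by exact_mod_cast (Nat.bodd_add_div2 a).symm
  have hb : (b : ℤ) = b.bodd.toNat + 2 * b.div2 := by exact_mod_cast (Nat.bodd_add_div2 b).symm
  simp only [carryValue, carryStep]
  rw [ha, hb]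
  cases neg <;> cases a.bodd <;> cases b.bodd <;> cases c <;> simp [msbVal, pow_succ] <;> ring

theorem carryValue_iterate (neg : Bool) (a b k : ℕ) :
    carryValue neg ((carryStep neg)^[k] ((a, b), false, [])) =
      a + (if neg then -1 else 1) * b := by
  induction k with
  | zero => simp [carryValue, msbVal]
  | succ k ih => rw [Function.iterate_succ_apply', carryValue_carryStep, ih]

theorem carryStep_iterate_remaining (neg : Bool) (a b k : ℕ) :
    ((carryStep neg)^[k] ((a, b), false, [])).1 = (a / 2 ^ k, b / 2 ^ k) := by
  induction k with
  | zero => simp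
  | succ k ih =>
    rw [Function.iterate_succ_apply', carryStep, ih]
    simp only [Nat.div2_val, Nat.div_div_eq_div_mul, pow_succ]

theorem length_carryStep_iterate (neg : Bool) (a b k : ℕ) :
    ((carryStep neg)^[k] ((a, b), false, [])).2.2.length = k := by
  induction k with
  | zero => rfl
  | succ k ih => rw [Function.iterate_succ_apply', carryStep, List.length_cons, ih]

/-- The final carry and the digits of `a + b` (or `a - b`, if `neg`). -/
def carryAdd (neg : Bool) (a b : ℕ) : Bool × List Bool :=
  ((a.bits ++ (b.bits ++ [true])).foldl (fun s _ => carryStep neg s) ((a, b), false, [])).2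

theorem msbVal_carryAdd (neg : Bool) (a b : ℕ) :
    a + b < 2 ^ (carryAdd neg a b).2.length ∧
      (msbVal (carryAdd neg a b).2 : ℤ) + (2 ^ (carryAdd neg a b).2.length : ℕ) *
        ((if neg then -1 else 1) * (carryAdd neg a b).1.toNat) =
        a + (if neg then -1 else 1) * b := by
  set k := a.size + b.size + 1 with hk
  have hcarry : carryAdd neg a b = ((carryStep neg)^[k] ((a, b), false, [])).2 := by
    rw [carryAdd, List.foldl_const]
    simp [Nat.size_eq_bits_len, hk, add_assoc]
  have hvalue := carryValue_iterate neg a b k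
  have hremaining := carryStep_iterate_remaining neg a b k
  have hlength := length_carryStep_iterate neg a b k
  have ha : a < 2 ^ (a.size + b.size) := Nat.size_le.1 (by omega)
  have hb : b < 2 ^ (a.size + b.size) := Nat.size_le.1 (by omega)
  have hpow : 2 ^ k = 2 * 2 ^ (a.size + b.size) := pow_succ' ..
  rw [hcarry, hlength]
  refine ⟨by omega, ?_⟩
  rw [carryValue, hremaining, hlength, Nat.div_eq_of_lt (by omega),
    Nat.div_eq_of_lt (by omega)] at hvalue
  simpa using hvalue

theorem msbVal_carryAdd_false (a b : ℕ) : msbVal (carryAdd false a b).2 = a + b := by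
  obtain ⟨hlt, hvalue⟩ := msbVal_carryAdd false a b
  cases h : (carryAdd false a b).1 <;> simp [h] at hvalue <;> norm_cast at hvalue
  omega

theorem carryAdd_true_fst (a b : ℕ) : (carryAdd true a b).1 = decide (a < b) := by
  obtain ⟨-, hvalue⟩ := msbVal_carryAdd true a b
  have hlt := msbVal_lt (carryAdd true a b).2
  cases h : (carryAdd true a b).1 <;> rw [h] at hvalue
  · simp at hvalue
    simp
    omega
  · have : ((2 ^ (carryAdd true a b).2.length : ℕ) : ℤ) > msbVal (carryAdd true a b).2 := by
      exact_mod_cast hlt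
    simp at hvalue this
    simp
    omega

theorem msbVal_carryAdd_true {a b : ℕ} (hba : b ≤ a) :
    msbVal (carryAdd true a b).2 = a - b := by
  have hvalue := (msbVal_carryAdd true a b).2
  rw [carryAdd_true_fst, decide_eq_false (by omega)] at hvalue
  simp at hvalue
  omega

theorem foldl_double_add (a b : ℕ) :
    a.bits.reverse.foldl (fun s c => Nat.bit false s + if c then b else 0) 0 = a * b := by
  rw [List.foldl_reverse]
  induction a using Nat.binaryRec' with
  | zero => simp
  | bit u n h ih =>
    rw [Nat.bits_append_bit _ _ h, List.foldr_cons, ih]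
    cases u <;> simp [Nat.bit_val] <;> ring

namespace PolyTime

variable {ι α β : Type*} [Enc α] [Enc β] {Γ : Promise ι α}

theorem bits {f : ι → α → ℕ} (hf : PolyTime Γ f) : PolyTime Γ fun i x => (f i x).bits :=
  hf.congr_enc fun _ _ _ => rfl

theorem bodd {f : ι → α → ℕ} (hf : PolyTime Γ f) : PolyTime Γ fun i x => (f i x).bodd :=
  (comp (g := fun _ (l : List Bool) => l.headI)
    (of_prog .hd 1 fun _ l _ => by cases l <;> exact RunWithin.hd _) hf.bits).congr
    fun i x _ => (Nat.bodd_eq_bits_head _).symm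

theorem div2 {f : ι → α → ℕ} (hf : PolyTime Γ f) : PolyTime Γ fun i x => (f i x).div2 :=
  hf.bits.tail.congr_enc fun i x _ => by rw [enc_nat (f i x).div2, Nat.div2_bits_eq_tail]

theorem bit {b : ι → α → Bool} {f : ι → α → ℕ} (hb : PolyTime Γ b) (hf : PolyTime Γ f) :
    PolyTime Γ fun i x => Nat.bit (b i x) (f i x) :=
  (ite (hb.or hf.bits.isEmpty.not) (hb.cons hf.bits) (const Γ fun _ => [])).congr_enc
    fun _ _ _ => (enc_nat_bit _ _).symm

theorem msbVal {f : ι → α → List Bool} (hf : PolyTime Γ f) :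
    PolyTime Γ fun i x => msbVal (f i x) := by
  refine (foldl_of_height_step_le (h := fun _ y => Nat.bit y.2.2 y.2.1) hf (const Γ fun _ => 0)
    (bit (id _).snd.snd (id _).snd.fst) (PolyBounded.const Γ fun _ => 2)
    fun _ _ s b _ _ => ?_).congr fun i x _ => by simp [foldl_bit]
  have := height_enc_bool_le b
  rw [enc_nat_bit, enc_nat s]
  split_ifs
  · simp only [enc_cons, Data.height_node]
    omega
  · simp

theorem carryAdd (neg : Bool) {f g : ι → α → ℕ} (hf : PolyTime Γ f) (hg : PolyTime Γ g) :
    PolyTime Γ fun i x => carryAdd neg (f i x) (g i x) := by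
  have hs : PolyTime (Γ.fold (fun i x => (f i x).bits ++ ((g i x).bits ++ [true])) CarryState)
    fun _ y => y.2.1 := (id _).snd.fst
  have hstep := (hs.fst.fst.div2.pair hs.fst.snd.div2).pair
    ((((hs.fst.fst.bodd.xor (const _ fun _ => neg)).and (hs.fst.snd.bodd.or hs.snd.fst)).or
      (hs.fst.snd.bodd.and hs.snd.fst)).pair
      ((hs.fst.fst.bodd.xor (hs.fst.snd.bodd.xor hs.snd.fst)).cons hs.snd.snd))
  refine (foldl_of_height_step_le (h := fun _ y => carryStep neg y.2.1)
    (hf.bits.append (hg.bits.append (const Γ fun _ => [true])))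
    ((hf.pair hg).pair (const Γ fun _ => (false, []))) hstep (PolyBounded.const Γ fun _ => 5)
    fun _ _ ⟨⟨a, b⟩, c, l⟩ _ _ _ => ?_).snd
  have ha := height_enc_tail_le a.bits
  have hb := height_enc_tail_le b.bits
  rw [← Nat.div2_bits_eq_tail, ← enc_nat, ← enc_nat] at ha hb
  have hbool := height_enc_bool_le
  simp only [carryStep, enc_mk, enc_cons, Data.height_node]
  grind

theorem nat_add {f g : ι → α → ℕ} (hf : PolyTime Γ f) (hg : PolyTime Γ g) :
    PolyTime Γ fun i x => f i x + g i x :=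
  (hf.carryAdd false hg).snd.msbVal.congr fun _ _ _ => msbVal_carryAdd_false _ _

theorem nat_mul {f g : ι → α → ℕ} (hf : PolyTime Γ f) (hg : PolyTime Γ g) :
    PolyTime Γ fun i x => f i x * g i x := by
  refine (foldl_of_height_step_le (B := fun i x => (enc (g i x)).height + 3)
    (h := fun i (y : α × ℕ × Bool) => Nat.bit false y.2.1 + if y.2.2 then g i y.1 else 0)
    hf.bits.reverse (const _ fun _ => 0) ((bit (const _ fun _ => false) (id _).snd.fst).nat_add
      (ite (id _).snd.snd (hg.comp_of_dom (id _).fst (fun _ _ hy => hy.1) (PolyBounded.budget _))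
        (const _ fun _ => 0)))
    (hg.height.add_const fun _ => 3) fun i x s b _ _ => ?_).congr
    fun i x _ => foldl_double_add (f i x) (g i x)
  have hs := (lt_two_pow_height_enc s).trans_le (Nat.pow_le_pow_right two_pos
    (Nat.le_add_right _ (enc (g i x)).height))
  have hg := (lt_two_pow_height_enc (g i x)).trans_le (Nat.pow_le_pow_right two_pos
    (Nat.le_add_left _ (enc s).height))
  refine (height_enc_nat_le (k := (enc s).height + (enc (g i x)).height + 2) ?_).trans (by omega)
  rw [pow_add _ _ 2, Nat.bit_val]
  split_ifs <;> simp only [Bool.toNat_false] <;> omega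

theorem int_neg_natAbs {f : ι → α → ℤ} (hf : PolyTime Γ f) :
    PolyTime Γ fun i x => (decide (f i x < 0), (f i x).natAbs) :=
  hf.congr_enc fun _ _ _ => enc_int _

theorem nat_sub_cast {f g : ι → α → ℕ} (hf : PolyTime Γ f) (hg : PolyTime Γ g) :
    PolyTime Γ fun i x => (f i x : ℤ) - g i x := by
  refine ((hf.carryAdd true hg).fst.pair (ite (hf.carryAdd true hg).fst
    (hg.carryAdd true hf).snd.msbVal (hf.carryAdd true hg).snd.msbVal)).congr_enc fun i x _ => ?_
  rw [carryAdd_true_fst, enc_int, enc_mk, enc_mk]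
  congr 2
  · simp only [sub_neg, Nat.cast_lt]
  · by_cases hlt : f i x < g i x
    · rw [if_pos (decide_eq_true hlt), msbVal_carryAdd_true hlt.le]
      omega
    · rw [if_neg (by simpa using hlt), msbVal_carryAdd_true (not_lt.1 hlt)]
      omega

theorem nat_cast {f : ι → α → ℕ} (hf : PolyTime Γ f) : PolyTime Γ fun i x => (f i x : ℤ) :=
  (hf.nat_sub_cast (const Γ fun _ => 0)).congr fun i x _ => by simp

theorem int_toNat {f : ι → α → ℤ} (hf : PolyTime Γ f) :
    PolyTime Γ fun i x => (f i x).toNat :=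
  (ite hf.int_neg_natAbs.fst (const Γ fun _ => 0) hf.int_neg_natAbs.snd).congr
    fun i x _ => by
      simp only [decide_eq_true_eq]
      split_ifs <;> omega

theorem int_toNat_neg {f : ι → α → ℤ} (hf : PolyTime Γ f) :
    PolyTime Γ fun i x => (-f i x).toNat :=
  (ite hf.int_neg_natAbs.fst hf.int_neg_natAbs.snd (const Γ fun _ => 0)).congr
    fun i x _ => by
      simp only [decide_eq_true_eq]
      split_ifs <;> omega

theorem int_add {f g : ι → α → ℤ} (hf : PolyTime Γ f) (hg : PolyTime Γ g) :
    PolyTime Γ fun i x => f i x + g i x :=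
  ((hf.int_toNat.nat_add hg.int_toNat).nat_sub_cast
    (hf.int_toNat_neg.nat_add hg.int_toNat_neg)).congr fun i x _ => by
      push_cast
      linarith [Int.toNat_sub_toNat_neg (f i x), Int.toNat_sub_toNat_neg (g i x)]

theorem int_mul {f g : ι → α → ℤ} (hf : PolyTime Γ f) (hg : PolyTime Γ g) :
    PolyTime Γ fun i x => f i x * g i x :=
  (((hf.int_toNat.nat_mul hg.int_toNat).nat_add
      (hf.int_toNat_neg.nat_mul hg.int_toNat_neg)).nat_sub_cast
    ((hf.int_toNat.nat_mul hg.int_toNat_neg).nat_add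
      (hf.int_toNat_neg.nat_mul hg.int_toNat))).congr fun i x _ => by
      conv_rhs => rw [← Int.toNat_sub_toNat_neg (f i x), ← Int.toNat_sub_toNat_neg (g i x)]
      push_cast
      ring

theorem int_sum {κ : Type*} (s : Finset κ) {f : κ → ι → α → ℤ}
    (hf : ∀ j ∈ s, PolyTime Γ (f j)) : PolyTime Γ fun i x => ∑ j ∈ s, f j i x := by
  classical
  induction s using Finset.induction_on with
  | empty => exact (const Γ fun _ => (0 : ℤ)).congr fun _ _ _ => by simp
  | insert a s ha ih =>
    exact ((hf a (by simp)).int_add (ih fun j hj => hf j (by simp [hj]))).congr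
      fun i x _ => by rw [Finset.sum_insert ha]

theorem flatten {f : ι → α → List (List β)} (hf : PolyTime Γ f) :
    PolyTime Γ fun i x => (f i x).flatten := by
  refine (foldl_of_height_step_le (h := fun _ (y : α × List β × List β) => y.2.1 ++ y.2.2) hf
    (const Γ fun _ => []) ((id _).snd.fst.append (id _).snd.snd) hf.height
    fun i x s b _ hb => ?_).congr fun i x _ => ?_
  · have := height_enc_le_of_mem hb
    have := height_enc_append_le s b
    dsimp only
    omega
  · rw [List.foldl_append_eq_append]
    simp

end PolyTime

/-! ### Rational coordinates -/

/-- A vector with rational coordinates: a common denominator and the numerators. -/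
abbrev RatVec (r : ℕ) := ℕ × (Fin r → ℤ)

/-- A square matrix with rational entries: a common denominator and the numerators. -/
abbrev RatMat (r : ℕ) := ℕ × (Fin r → Fin r → ℤ)

section RatVec

variable {r : ℕ}

/-- The product of a matrix and a vector, without cancelling common factors. -/
def RatMat.app (M : RatMat r) (v : RatVec r) : RatVec r :=
  (M.1 * v.1, fun i => ∑ j, M.2 i j * v.2 j)

/-- The result of applying the matrices in `L` to `v`, the head of `L` first. -/
def RatMat.appAll (L : List (RatMat r)) (v : RatVec r) : RatVec r := L.foldl (fun v M => M.app v) v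

/-- The sum of two vectors, over the product of the denominators. -/
def RatVec.add (v w : RatVec r) : RatVec r := (v.1 * w.1, fun i => v.2 i * w.1 + w.2 i * v.1)

/-- The sum of the vectors in `l`. -/
def RatVec.sum (l : List (RatVec r)) : RatVec r := l.foldl RatVec.add (1, 0)

/-- Half the vector: the denominator is doubled by prepending a binary digit `0`. -/
def RatVec.half (v : RatVec r) : RatVec r := (Nat.bit false v.1, v.2)

theorem RatVec.height_enc_le {v : RatVec r} {k : ℕ} (hden : v.1 < 2 ^ k)
    (hnum : ∀ i, (v.2 i).natAbs < 2 ^ k) : (enc v).height ≤ k + r + 3 := by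
  have h₁ := height_enc_nat_le hden
  have h₂ := height_enc_fin_le fun j => height_enc_int_le (hnum j)
  rw [enc_prod, Data.height_node]
  omega

theorem RatVec.fst_lt (v : RatVec r) : v.1 < 2 ^ (enc v).height := by
  refine (lt_two_pow_height_enc v.1).trans_le (Nat.pow_le_pow_right two_pos ?_)
  rw [enc_prod, Data.height_node]
  omega

theorem RatVec.natAbs_snd_lt (v : RatVec r) (i : Fin r) :
    (v.2 i).natAbs < 2 ^ (enc v).height := by
  refine (natAbs_lt_two_pow_height_enc (v.2 i)).trans_le (Nat.pow_le_pow_right two_pos ?_)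
  have := height_enc_apply_le v.2 i
  rw [enc_prod, Data.height_node]
  omega

theorem RatMat.fst_lt (M : RatMat r) : M.1 < 2 ^ (enc M).height := by
  refine (lt_two_pow_height_enc M.1).trans_le (Nat.pow_le_pow_right two_pos ?_)
  rw [enc_prod, Data.height_node]
  omega

theorem RatMat.natAbs_snd_lt (M : RatMat r) (i j : Fin r) :
    (M.2 i j).natAbs < 2 ^ (enc M).height := by
  refine (natAbs_lt_two_pow_height_enc (M.2 i j)).trans_le (Nat.pow_le_pow_right two_pos ?_)
  have := height_enc_apply_le (M.2 i) j
  have := height_enc_apply_le M.2 i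
  rw [enc_prod, Data.height_node]
  omega

theorem RatMat.height_enc_app_le (M : RatMat r) (v : RatVec r) :
    (enc (M.app v)).height ≤ (enc v).height + ((enc M).height + 2 * r + 3) := by
  set k := (enc M).height + (enc v).height with hk
  have hden : M.1 * v.1 < 2 ^ k := by
    rw [hk, pow_add]
    exact Nat.mul_lt_mul'' M.fst_lt v.fst_lt
  have hnum (i j : Fin r) : (M.2 i j * v.2 j).natAbs < 2 ^ k := by
    rw [hk, pow_add, Int.natAbs_mul]
    exact Nat.mul_lt_mul'' (M.natAbs_snd_lt i j) (v.natAbs_snd_lt j)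
  refine (RatVec.height_enc_le (k := k + r)
    (hden.trans_le (Nat.pow_le_pow_right two_pos (by omega))) fun i => ?_).trans (by omega)
  calc (∑ j, M.2 i j * v.2 j).natAbs ≤ ∑ j, (M.2 i j * v.2 j).natAbs := Int.natAbs_sum_le _ _
    _ ≤ ∑ _j : Fin r, 2 ^ k := Finset.sum_le_sum fun j _ => (hnum i j).le
    _ = 2 ^ k * r := by simp [mul_comm]
    _ < 2 ^ k * 2 ^ r := Nat.mul_lt_mul_of_pos_left Nat.lt_two_pow_self (by positivity)
    _ = 2 ^ (k + r) := (pow_add ..).symm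

theorem RatVec.height_enc_add_le (v w : RatVec r) :
    (enc (v.add w)).height ≤ (enc v).height + ((enc w).height + r + 4) := by
  have hden : v.1 * w.1 < 2 ^ ((enc v).height + (enc w).height) := by
    rw [pow_add]
    exact Nat.mul_lt_mul'' v.fst_lt w.fst_lt
  have hnum (v w : RatVec r) (i : Fin r) :
      (v.2 i * w.1).natAbs < 2 ^ ((enc v).height + (enc w).height) := by
    rw [pow_add, Int.natAbs_mul, Int.natAbs_natCast]
    exact Nat.mul_lt_mul'' (v.natAbs_snd_lt i) w.fst_lt
  refine (RatVec.height_enc_le (k := (enc v).height + (enc w).height + 1)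
    (hden.trans_le (Nat.pow_le_pow_right two_pos (by omega))) fun i => ?_).trans (by omega)
  have hsum := Int.natAbs_add_le (v.2 i * w.1) (w.2 i * v.1)
  have hvw := hnum v w i
  have hwv := hnum w v i
  rw [add_comm (enc w).height] at hwv
  rw [pow_succ]
  change (v.2 i * w.1 + w.2 i * v.1).natAbs < _
  omega

theorem RatVec.height_enc_half_le (v : RatVec r) : (enc v.half).height ≤ (enc v).height + 1 := by
  rw [RatVec.half, enc_mk, enc_prod v, enc_nat_bit, enc_nat v.1]
  split_ifs <;> simp only [enc_cons, enc_false, enc_nil, Data.height_node, Data.height_leaf] <;>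
    omega

namespace PolyTime

variable {ι α β : Type*} [Enc α] [Enc β] {Γ : Promise ι α}

theorem ratMat_app {M : ι → α → RatMat r} {v : ι → α → RatVec r} (hM : PolyTime Γ M)
    (hv : PolyTime Γ v) : PolyTime Γ fun i x => (M i x).app (v i x) :=
  (hM.fst.nat_mul hv.fst).pair (tuple fun k => int_sum Finset.univ
    (f := fun j i x => (M i x).2 k j * (v i x).2 j)
    fun j _ => ((hM.snd.apply k).apply j).int_mul (hv.snd.apply j))

theorem ratMat_appAll {L : ι → α → List (RatMat r)} {v : ι → α → RatVec r}
    (hL : PolyTime Γ L) (hv : PolyTime Γ v) :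
    PolyTime Γ fun i x => RatMat.appAll (L i x) (v i x) :=
  foldl_of_height_step_le (h := fun _ (y : α × RatVec r × RatMat r) => y.2.2.app y.2.1) hL hv
    (ratMat_app (id _).snd.snd (id _).snd.fst) (hL.height.add_const fun _ => 2 * r + 3)
    fun _ _ s M _ hM => by
      have := height_enc_le_of_mem hM
      have := M.height_enc_app_le s
      dsimp only
      omega

theorem ratVec_add {v w : ι → α → RatVec r} (hv : PolyTime Γ v) (hw : PolyTime Γ w) :
    PolyTime Γ fun i x => (v i x).add (w i x) :=
  (hv.fst.nat_mul hw.fst).pair (tuple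
    (f := fun i x k => (v i x).2 k * (w i x).1 + (w i x).2 k * (v i x).1) fun k =>
    ((hv.snd.apply k).int_mul hw.fst.nat_cast).int_add ((hw.snd.apply k).int_mul hv.fst.nat_cast))

theorem ratVec_sum {l : ι → α → List (RatVec r)} (hl : PolyTime Γ l) :
    PolyTime Γ fun i x => RatVec.sum (l i x) :=
  foldl_of_height_step_le (h := fun _ (y : α × RatVec r × RatVec r) => y.2.1.add y.2.2) hl
    (const Γ fun _ => (1, 0)) (ratVec_add (id _).snd.fst (id _).snd.snd)
    (hl.height.add_const fun _ => r + 4) fun _ _ s v _ hv => by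
      have := height_enc_le_of_mem hv
      have := s.height_enc_add_le v
      dsimp only
      omega

theorem ratVec_half_iterate {l : ι → α → List β} {v : ι → α → RatVec r} (hl : PolyTime Γ l)
    (hv : PolyTime Γ v) : PolyTime Γ fun i x => RatVec.half^[(l i x).length] (v i x) :=
  (foldl_of_height_step_le (h := fun _ (y : α × RatVec r × β) => y.2.1.half) hl hv
    (((const _ fun _ => false).bit (id _).snd.fst.fst).pair (id _).snd.fst.snd)
    (PolyBounded.const Γ fun _ => 1) fun _ _ s _ _ _ => s.height_enc_half_le).congr
    fun _ _ _ => List.foldl_const _ _ _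

end PolyTime

end RatVec

/-! ### Expanding products of binomials -/

/-- The binomial `a * t₁ * ⋯ * tₗ + b`, encoded as `((a, b), [t₁, …, tₗ])`. The factors `tⱼ` stay
symbolic, as they are going to be constraints of an instance. -/
abbrev Binomial (μ γ : Type*) := (μ × μ) × List γ

section Expand

variable {μ μ' γ γ' : Type*}

/-- The binomial with coefficients and symbols replaced according to `f` and `g`. -/
def Binomial.map (f : μ → μ') (g : γ → γ') (s : Binomial μ γ) : Binomial μ' γ' :=
  ((f s.1.1, f s.1.2), s.2.map g)

/-- The product of a binomial and a sum. A pair `(A, T)` in the list `L` is the term of the sum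
which is the product of the coefficients in `A` and the symbols in `T`. -/
def expandStep (L : List (List μ × List γ)) (s : Binomial μ γ) : List (List μ × List γ) :=
  (L.map fun p => (s.1.1 :: p.1, s.2 ++ p.2)) ++ L.map fun p => (s.1.2 :: p.1, p.2)

/-- The terms of the product of the binomials in `l` and the symbols in `base`. -/
def expand (l : List (Binomial μ γ)) (base : List γ) : List (List μ × List γ) :=
  l.foldl expandStep [([], base)]

theorem mem_expandStep {L : List (List μ × List γ)} {s : Binomial μ γ} {p : List μ × List γ} :
    p ∈ expandStep L s ↔
      ∃ q ∈ L, p = (s.1.1 :: q.1, s.2 ++ q.2) ∨ p = (s.1.2 :: q.1, q.2) := by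
  simp only [expandStep, List.mem_append, List.mem_map, and_or_left, exists_or, eq_comm]

theorem length_foldl_expandStep (l : List (Binomial μ γ)) (L : List (List μ × List γ)) :
    (l.foldl expandStep L).length = 2 ^ l.length * L.length := by
  induction l generalizing L with
  | nil => simp
  | cons s l ih =>
    rw [List.foldl_cons, ih, List.length_cons, pow_succ, expandStep]
    simp only [List.length_append, List.length_map]
    ring

theorem coeff_of_mem_foldl_expandStep {P : μ → Prop} (l : List (Binomial μ γ))
    {L : List (List μ × List γ)} (hl : ∀ s ∈ l, P s.1.1 ∧ P s.1.2)
    (hL : ∀ p ∈ L, ∀ a ∈ p.1, P a) : ∀ p ∈ l.foldl expandStep L, ∀ a ∈ p.1, P a := by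
  induction l generalizing L with
  | nil => exact hL
  | cons s l ih =>
    refine ih (fun t ht => hl t (List.mem_cons_of_mem s ht)) fun p hp => ?_
    obtain ⟨ha, hb⟩ := hl s List.mem_cons_self
    obtain ⟨q, hq, rfl | rfl⟩ := mem_expandStep.1 hp
    · exact List.forall_mem_cons.2 ⟨ha, hL q hq⟩
    · exact List.forall_mem_cons.2 ⟨hb, hL q hq⟩

theorem coeff_of_mem_expand {P : μ → Prop} {l : List (Binomial μ γ)} {base : List γ}
    (hl : ∀ s ∈ l, P s.1.1 ∧ P s.1.2) {p : List μ × List γ} (hp : p ∈ expand l base) :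
    ∀ a ∈ p.1, P a :=
  coeff_of_mem_foldl_expandStep l hl (by simp) p hp

theorem countP_le_of_mem_foldl_expandStep (P : γ → Bool) (l : List (Binomial μ γ))
    {L : List (List μ × List γ)} {B : ℕ} (hL : ∀ p ∈ L, p.2.countP P ≤ B) :
    ∀ p ∈ l.foldl expandStep L, p.2.countP P ≤ (l.map fun s => s.2.countP P).sum + B := by
  induction l generalizing L B with
  | nil => simpa using hL
  | cons s l ih =>
    have hstep : ∀ p ∈ expandStep L s, p.2.countP P ≤ s.2.countP P + B := fun p hp => by
      obtain ⟨q, hq, rfl | rfl⟩ := mem_expandStep.1 hp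
      · rw [List.countP_append]
        exact Nat.add_le_add_left (hL q hq) _
      · exact le_add_left (hL q hq)
    intro p hp
    have := ih hstep p hp
    rw [List.map_cons, List.sum_cons]
    omega

theorem countP_le_of_mem_expand (P : γ → Bool) {l : List (Binomial μ γ)} {base : List γ}
    {p : List μ × List γ} (hp : p ∈ expand l base) :
    p.2.countP P ≤ (l.map fun s => s.2.countP P).sum + base.countP P :=
  countP_le_of_mem_foldl_expandStep P l (by simp) p hp

theorem foldl_expandStep_map (f : μ → μ') (g : γ → γ') (l : List (Binomial μ γ))
    (L : List (List μ × List γ)) :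
    (l.map (Binomial.map f g)).foldl expandStep (L.map fun p => (p.1.map f, p.2.map g)) =
      (l.foldl expandStep L).map fun p => (p.1.map f, p.2.map g) := by
  induction l generalizing L with
  | nil => rfl
  | cons s l ih =>
    rw [List.map_cons, List.foldl_cons, List.foldl_cons, ← ih]
    simp [expandStep, Binomial.map, Function.comp_def]

theorem expand_map (f : μ → μ') (g : γ → γ') (l : List (Binomial μ γ)) (base : List γ) :
    expand (l.map (Binomial.map f g)) (base.map g) =
      (expand l base).map fun p => (p.1.map f, p.2.map g) :=
  foldl_expandStep_map f g l [([], base)]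

section Value

variable {R : Type*} [CommSemiring R]

/-- The value of a binomial, given the values of the symbols. -/
def Binomial.eval (w : γ → R) (s : Binomial R γ) : R := s.1.1 * (s.2.map w).prod + s.1.2

/-- The value of a sum of terms, given the values of the symbols. -/
def termSum (w : γ → R) (L : List (List R × List γ)) : R :=
  (L.map fun p => p.1.prod * (p.2.map w).prod).sum

theorem termSum_expandStep (w : γ → R) (L : List (List R × List γ)) (s : Binomial R γ) :
    termSum w (expandStep L s) = s.eval w * termSum w L := by
  simp only [termSum, expandStep, Binomial.eval, List.map_append, List.sum_append, List.map_map,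
    add_mul]
  rw [← List.sum_map_mul_left, ← List.sum_map_mul_left]
  congr 2 <;> refine List.map_congr_left fun p _ => ?_
  · simp only [Function.comp_apply, List.prod_cons, List.map_append, List.prod_append]
    ring
  · simp only [Function.comp_apply, List.prod_cons]
    ring

theorem termSum_foldl_expandStep (w : γ → R) (l : List (Binomial R γ))
    (L : List (List R × List γ)) :
    termSum w (l.foldl expandStep L) = (l.map (Binomial.eval w)).prod * termSum w L := by
  induction l generalizing L with
  | nil => simp
  | cons s l ih =>
    rw [List.foldl_cons, ih, termSum_expandStep, List.map_cons, List.prod_cons]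
    ring

theorem termSum_expand (w : γ → R) (l : List (Binomial R γ)) (base : List γ) :
    termSum w (expand l base) = (l.map (Binomial.eval w)).prod * (base.map w).prod := by
  rw [expand, termSum_foldl_expandStep]
  simp [termSum]

end Value

variable [Enc μ] [Enc γ]

theorem height_enc_le_of_mem_expandStep {L : List (List μ × List γ)} {s : Binomial μ γ} {H M : ℕ}
    (hs : (enc s).height ≤ H) (hL : ∀ p ∈ L, (enc p).height ≤ M) :
    ∀ p ∈ expandStep L s, (enc p).height ≤ M + (H + 1) := by
  intro p hp
  obtain ⟨q, hq, hpq⟩ := mem_expandStep.1 hp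
  have hM := hL q hq
  have happend := height_enc_append_le s.2 q.2
  rw [enc_prod, enc_prod s.1, Data.height_node, Data.height_node] at hs
  rw [enc_prod, Data.height_node] at hM
  rcases hpq with rfl | rfl <;> simp only [enc_mk, enc_cons, Data.height_node] <;> omega

theorem height_enc_le_of_mem_foldl_expandStep (l : List (Binomial μ γ))
    {L : List (List μ × List γ)} {H M : ℕ} (hl : ∀ s ∈ l, (enc s).height ≤ H)
    (hL : ∀ p ∈ L, (enc p).height ≤ M) :
    ∀ p ∈ l.foldl expandStep L, (enc p).height ≤ M + l.length * (H + 1) := by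
  induction l generalizing L M with
  | nil => simpa using hL
  | cons s l ih =>
    intro p hp
    refine (ih (fun t ht => hl t (List.mem_cons_of_mem s ht))
      (height_enc_le_of_mem_expandStep (hl s List.mem_cons_self) hL) p hp).trans_eq ?_
    rw [List.length_cons]
    ring

theorem height_enc_foldl_expandStep_le {l pre suf : List (Binomial μ γ)} (base : List γ)
    (hl : l = pre ++ suf) :
    (enc (pre.foldl expandStep [([], base)])).height ≤
      2 ^ l.length + ((enc base).height + 1 + (enc l).height * ((enc l).height + 1)) := by
  have hlength : pre.length ≤ l.length := by simp [hl]
  have hterm := height_enc_le_of_mem_foldl_expandStep pre (M := (enc base).height + 1)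
    (fun s hs => height_enc_le_of_mem (l := l) (by simp [hl, hs]))
    (L := [([], base)]) (by simp)
  have hcount := length_foldl_expandStep pre [(([] : List μ), base)]
  rw [List.length_singleton, mul_one] at hcount
  have hpow : 2 ^ pre.length ≤ 2 ^ l.length := Nat.pow_le_pow_right two_pos hlength
  have hmul := Nat.mul_le_mul_right ((enc l).height + 1) (hlength.trans (length_le_height_enc l))
  have := height_enc_list_le hterm
  omega

namespace PolyTime

variable {ι α : Type*} [Enc α] {Γ : Promise ι α}

theorem expandStep {L : ι → α → List (List μ × List γ)} {s : ι → α → Binomial μ γ}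
    (hL : PolyTime Γ L) (hs : PolyTime Γ s) :
    PolyTime Γ fun i x => expandStep (L i x) (s i x) := by
  refine comp₂ (h := fun _ L s => PinCSP.expandStep L s) (append ?_ ?_) hL hs
  · exact map (f := fun _ (y : (List (List μ × List γ) × Binomial μ γ) × (List μ × List γ)) =>
        (y.1.2.1.1 :: y.2.1, y.1.2.2 ++ y.2.2)) (id _).fst
      (((id _).fst.snd.fst.fst.cons (id _).snd.fst).pair
        ((id _).fst.snd.snd.append (id _).snd.snd))
  · exact map (f := fun _ (y : (List (List μ × List γ) × Binomial μ γ) × (List μ × List γ)) =>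
        (y.1.2.1.2 :: y.2.1, y.2.2)) (id _).fst
      (((id _).fst.snd.fst.snd.cons (id _).snd.fst).pair (id _).snd.snd)

theorem expand {l : ι → α → List (Binomial μ γ)} {base : ι → α → List γ} (hl : PolyTime Γ l)
    (hbase : PolyTime Γ base) (hterms : PolyBounded Γ fun i x => 2 ^ (l i x).length) :
    PolyTime Γ fun i x => expand (l i x) (base i x) :=
  foldl (h := fun _ (y : α × List (List μ × List γ) × Binomial μ γ) =>
      PinCSP.expandStep y.2.1 y.2.2) hl
    (((const Γ fun _ => []).pair hbase).cons (const Γ fun _ => []))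
    (expandStep (id _).snd.fst (id _).snd.snd)
    (hterms.add ((hbase.height.add_const fun _ => 1).add
      (hl.height.mul (hl.height.add_const fun _ => 1))))
    fun i x _ _ _ hsplit => height_enc_foldl_expandStep_le (base i x) hsplit

end PolyTime

end Expand

/-! ### The reduction on named instances -/

/-- A constraint as it appears in an input: the name of the function and the variables. -/
abbrev NamedCstr := Unary × List Unary

/-- An instance as it appears in an input: the number of variables and the constraints. -/
abbrev NamedInst := Unary × List NamedCstr

/-- The number of blocks into which the reduction divides `n` variables. A block consists of `d`
variables, so that the pins of at most `d` variables are replaced by the same vertex of a path. -/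
def numBlocks (d n : ℕ) : ℕ := n / d + 1

/-- The edges of a path on the variables `n, …, n + 2 * m`, oriented from the vertices at an even
distance from `n` to those at an odd distance. -/
def namedPathEdges (n m : ℕ) : List (Unary × Unary) :=
  ((List.range m).map fun b => (⟨n + (b + b)⟩, ⟨n + (b + b) + 1⟩)) ++
    (List.range m).map fun b => (⟨n + (b + b) + 1 + 1⟩, ⟨n + (b + b) + 1⟩)

/-- A binomial for every edge of the path, with matrices describing its coefficients. The symbol
`(s, [b₁, …, bₗ])` is the constraint with the function named `s` whose `j`-th argument is the first
vertex of the edge if `bⱼ` is `false`, and the second vertex otherwise. -/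
abbrev EdgeBinomial (r : ℕ) := Binomial (RatMat r) (Unary × List Bool)

/-- The constraint on the vertices of the edge `e` that the symbol `g` stands for. -/
def onEdge (e : Unary × Unary) (g : Unary × List Bool) : NamedCstr :=
  (g.1, g.2.map fun b => if b then e.2 else e.1)

namespace NamedInst

/-- Does a constraint with the function named `s` contain the variable `v`? In the reduction
`delta0` has the name `0`, and `delta1` has the name `1`. -/
def isPinned (x : NamedInst) (s : ℕ) (v : Unary) : Bool :=
  x.2.any fun c => decide (c.1.val = s) && c.2.any fun w => decide (w.val = v.val)

/-- The variable that replaces `v`: if `v` is pinned, a vertex of the path that belongs to the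
block of `v` and has the value to which `v` is pinned in the alternating assignment. -/
def substVar (d : ℕ) (x : NamedInst) (v : Unary) : Unary :=
  if x.isPinned 0 v then ⟨x.1.val + (v.val / d + v.val / d)⟩
  else if x.isPinned 1 v then ⟨x.1.val + (v.val / d + v.val / d) + 1⟩ else v

/-- The constraints other than pins, after the pinned variables have been replaced. -/
def residual (d : ℕ) (x : NamedInst) : List NamedCstr :=
  (x.2.filter fun c => !decide (c.1.val = 0) && !decide (c.1.val = 1)).map fun c =>
    (⟨c.1.val - 1 - 1⟩, c.2.map (substVar d x))

/-- The binomials whose product forces the alternating assignment of the path. -/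
def pathBinomials {r : ℕ} (S : List (EdgeBinomial r)) (d : ℕ) (x : NamedInst) :
    List (Binomial (RatMat r) NamedCstr) :=
  (namedPathEdges x.1.val (numBlocks d x.1.val)).flatMap fun e =>
    S.map (Binomial.map _root_.id (onEdge e))

/-- The terms into which the reduction expands an instance. -/
def terms {r : ℕ} (S : List (EdgeBinomial r)) (d : ℕ) (x : NamedInst) :
    List (List (RatMat r) × List NamedCstr) :=
  expand (x.pathBinomials S d) (x.residual d)

/-- The instance on the variables of `x` and those of the path with the constraints in `T`. -/
def onPath (d : ℕ) (x : NamedInst) (T : List NamedCstr) : NamedInst :=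
  (⟨x.1.val + (numBlocks d x.1.val + numBlocks d x.1.val + 1)⟩, T)

/-- The variables of `x`. -/
def varNames (x : NamedInst) : List Unary := (List.range x.1.val).map Unary.mk

/-- Is some variable pinned to both values? -/
def hasConflict (x : NamedInst) : Bool :=
  x.varNames.any fun v => x.isPinned 0 v && x.isPinned 1 v

/-- The variables which are pinned to some value. -/
def pinnedVars (x : NamedInst) : List Unary :=
  x.varNames.filter fun v => x.isPinned 0 v || x.isPinned 1 v

/-- The output of the reduction, given an oracle `O` for instances without pins. Every pinned
variable is unconstrained in the instances passed to the oracle, which doubles their values; the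
binomials in `S` may give rise to a further factor of `2 ^ k`. -/
def reduce {r : ℕ} (S : List (EdgeBinomial r)) (d k : ℕ) (O : NamedInst → RatVec r)
    (x : NamedInst) : RatVec r :=
  if x.hasConflict then (1, 0)
  else RatVec.half^[x.pinnedVars.length + k]
    (RatVec.sum ((x.terms S d).map fun p => RatMat.appAll p.1 (O (x.onPath d p.2))))

theorem length_pathBinomials {r : ℕ} (S : List (EdgeBinomial r)) (d : ℕ) (x : NamedInst) :
    (x.pathBinomials S d).length = 2 * numBlocks d x.1.val * S.length := by
  simp [pathBinomials, namedPathEdges, List.length_flatMap, Function.comp_def, two_mul,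
    add_mul]

end NamedInst

namespace PolyTime

variable {ι α : Type*} [Enc α] {Γ : Promise ι α} {r : ℕ} {d : ι → ℕ}

theorem numBlocks {n : ι → α → Unary} (hd : ∀ i, 0 < d i) (hn : PolyTime Γ n) :
    PolyTime Γ fun i x => Unary.mk (numBlocks (d i) (n i x).val) :=
  (unary_div hn d hd).unary_succ

theorem namedPathEdges {n m : ι → α → Unary} (hn : PolyTime Γ n) (hm : PolyTime Γ m) :
    PolyTime Γ fun i x => namedPathEdges (n i x).val (m i x).val := by
  refine comp₂ (h := fun _ (n m : Unary) => PinCSP.namedPathEdges n.val m.val) ?_ hn hm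
  have heven : PolyTime ((Promise.top ι (Unary × Unary)).elem
      fun _ y => (List.range y.2.val).map Unary.mk) fun _ (y : (Unary × Unary) × Unary) =>
        Unary.mk (y.1.1.val + (y.2.val + y.2.val)) :=
    unary_add (id _).fst.fst (unary_add (id _).snd (id _).snd)
  have hodd := heven.unary_succ
  refine ((map (unary_range (id _).snd) (heven.pair hodd)).append
    (map (unary_range (id _).snd) (hodd.unary_succ.pair hodd))).congr fun i x _ => ?_
  simp [PinCSP.namedPathEdges, Function.comp_def]

theorem onEdge {e : ι → α → Unary × Unary} {g : ι → α → Unary × List Bool}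
    (he : PolyTime Γ e) (hg : PolyTime Γ g) : PolyTime Γ fun i x => onEdge (e i x) (g i x) := by
  refine comp₂ (h := fun _ e g => PinCSP.onEdge e g) ((id _).snd.fst.pair ?_) he hg
  exact map (f := fun _ (y : ((Unary × Unary) × (Unary × List Bool)) × Bool) =>
    if y.2 then y.1.1.2 else y.1.1.1) (id _).snd.snd
    (ite (id _).snd (id _).fst.fst.snd (id _).fst.fst.fst)

theorem isPinned (s : ℕ) {x : ι → α → NamedInst} {v : ι → α → Unary} (hx : PolyTime Γ x)
    (hv : PolyTime Γ v) : PolyTime Γ fun i a => (x i a).isPinned s (v i a) := by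
  refine comp₂ (h := fun _ x v => NamedInst.isPinned x s v) ?_ hx hv
  refine any (f := fun _ (y : (NamedInst × Unary) × NamedCstr) => decide (y.2.1.val = s) &&
    y.2.2.any fun w => decide (w.val = y.1.2.val)) (id _).fst.snd ?_
  exact (unary_eq (id _).snd.fst (const _ fun _ => Unary.mk s)).and
    (any (f := fun _ (z : ((NamedInst × Unary) × NamedCstr) × Unary) =>
      decide (z.2.val = z.1.1.2.val)) (id _).snd.snd (unary_eq (id _).snd (id _).fst.fst.snd))

theorem substVar (hd : ∀ i, 0 < d i) {x : ι → α → NamedInst} {v : ι → α → Unary}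
    (hx : PolyTime Γ x) (hv : PolyTime Γ v) :
    PolyTime Γ fun i a => (x i a).substVar (d i) (v i a) := by
  have hblock := unary_div hv d hd
  have heven := unary_add hx.fst (unary_add hblock hblock)
  exact ite (isPinned 0 hx hv) heven (ite (isPinned 1 hx hv) heven.unary_succ hv)

theorem residual (hd : ∀ i, 0 < d i) :
    PolyTime (Promise.top ι NamedInst) fun i x => x.residual (d i) := by
  refine map (f := fun i (y : NamedInst × NamedCstr) =>
    ((⟨y.2.1.val - 1 - 1⟩, y.2.2.map (NamedInst.substVar (d i) y.1)) : NamedCstr)) ?_ ?_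
  · exact filter (f := fun _ (y : NamedInst × NamedCstr) =>
        !decide (y.2.1.val = 0) && !decide (y.2.1.val = 1)) (id _).snd
      ((unary_eq (id _).snd.fst (const _ fun _ => Unary.mk 0)).not.and
        (unary_eq (id _).snd.fst (const _ fun _ => Unary.mk 1)).not)
  · exact (id _).snd.fst.unary_pred.unary_pred.pair
      (map (f := fun i (z : (NamedInst × NamedCstr) × Unary) => z.1.1.substVar (d i) z.2)
        (id _).snd.snd (substVar hd (id _).fst.fst (id _).snd))

theorem pathBinomials (S : ι → List (EdgeBinomial r)) (hd : ∀ i, 0 < d i) :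
    PolyTime (Promise.top ι NamedInst) fun i x => x.pathBinomials (S i) (d i) := by
  refine flatten (map (f := fun i (y : NamedInst × (Unary × Unary)) =>
    (S i).map (Binomial.map _root_.id (PinCSP.onEdge y.2)))
    (namedPathEdges (id _).fst (numBlocks hd (id _).fst)) ?_)
  refine map (f := fun _ (z : (NamedInst × (Unary × Unary)) × EdgeBinomial r) =>
    Binomial.map _root_.id (PinCSP.onEdge z.1.2) z.2) (const _ S) ((id _).snd.fst.pair ?_)
  exact map (f := fun _ (w : ((NamedInst × (Unary × Unary)) × EdgeBinomial r) ×
      (Unary × List Bool)) => PinCSP.onEdge w.1.1.2 w.2) (id _).snd.snd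
    (onEdge (id _).fst.fst.snd (id _).snd)

theorem onPath {x : ι → α → NamedInst} {T : ι → α → List NamedCstr} (hd : ∀ i, 0 < d i)
    (hx : PolyTime Γ x) (hT : PolyTime Γ T) :
    PolyTime Γ fun i a => (x i a).onPath (d i) (T i a) := by
  have hblocks := numBlocks hd hx.fst
  exact (unary_add hx.fst (unary_add hblocks hblocks).unary_succ).pair hT

theorem hasConflict : PolyTime (Promise.top ι NamedInst) fun _ x => x.hasConflict :=
  any (f := fun _ (y : NamedInst × Unary) => y.1.isPinned 0 y.2 && y.1.isPinned 1 y.2)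
    (unary_range (id _).fst) ((isPinned 0 (id _).fst (id _).snd).and
      (isPinned 1 (id _).fst (id _).snd))

theorem pinnedVars : PolyTime (Promise.top ι NamedInst) fun _ x => x.pinnedVars :=
  filter (f := fun _ (y : NamedInst × Unary) => y.1.isPinned 0 y.2 || y.1.isPinned 1 y.2)
    (unary_range (id _).fst) ((isPinned 0 (id _).fst (id _).snd).or
      (isPinned 1 (id _).fst (id _).snd))

theorem reduce {Γ Δ : Promise ι NamedInst} {S : ι → List (EdgeBinomial r)} (k : ℕ)
    {O : ι → NamedInst → RatVec r} (hd : ∀ i, 0 < d i) (hO : PolyTime Δ O)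
    (hdom : ∀ i x, Γ.dom i x → ∀ p ∈ x.terms (S i) (d i), Δ.dom i (x.onPath (d i) p.2))
    (hbudget : ∀ i x, Γ.dom i x → ∀ p ∈ x.terms (S i) (d i),
      Δ.budget i (x.onPath (d i) p.2) ≤ Γ.budget i x)
    (hterms : ∀ i x, Γ.dom i x → 2 ^ (x.pathBinomials (S i) (d i)).length ≤ Γ.budget i x) :
    PolyTime Γ fun i x => x.reduce (S i) (d i) k (O i) := by
  have hexpand : PolyTime Γ fun i x => x.terms (S i) (d i) :=
    expand (of_top (pathBinomials S hd)) (of_top (residual hd))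
      ((PolyBounded.budget Γ).mono hterms)
  have hcall : PolyTime (Γ.elem fun i x => x.terms (S i) (d i)) fun i y =>
      O i (y.1.onPath (d i) y.2.2) :=
    comp_of_dom hO (onPath hd (id _).fst (id _).snd.snd) (fun i y hy => hdom i y.1 hy.1 y.2 hy.2)
      ((PolyBounded.budget _).mono fun i y hy => hbudget i y.1 hy.1 y.2 hy.2)
  have hsum := ratVec_sum (map (f := fun i (y : NamedInst × (List (RatMat r) × List NamedCstr)) =>
    RatMat.appAll y.2.1 (O i (y.1.onPath (d i) y.2.2))) hexpand
      (ratMat_appAll (id _).snd.fst hcall))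
  refine ite (of_top hasConflict) (const _ fun _ => (1, 0)) ?_
  exact (ratVec_half_iterate ((of_top pinnedVars).append
    (const Γ fun _ => List.replicate k (Unary.mk 0))) hsum).congr fun i x _ => by simp

end PolyTime

/-! ### Values of coordinate vectors -/

section RatVec

variable {r : ℕ} {ω : Fin r → ℂ}

/-- The vector `v` consists of coordinates of `w` with respect to `ω`. This is `Represents`, for
vectors instead of trees. -/
def RatVec.HasValue (ω : Fin r → ℂ) (v : RatVec r) (w : ℂ) : Prop :=
  0 < v.1 ∧ w = (∑ i, (v.2 i : ℂ) * ω i) / (v.1 : ℂ)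

/-- The matrix `M` describes the multiplication by `α` with respect to `ω`. -/
def RatMat.IsMul (ω : Fin r → ℂ) (M : RatMat r) (α : ℂ) : Prop :=
  ∀ v w, RatVec.HasValue ω v w → RatVec.HasValue ω (M.app v) (α * w)

theorem represents_iff {y : Data} {w : ℂ} :
    Represents ω y w ↔ ∃ v : RatVec r, y = enc v ∧ v.HasValue ω w :=
  ⟨fun ⟨q, z, hq, hy, hw⟩ => ⟨(q, z), hy, hq, hw⟩,
    fun ⟨v, hy, hv, hw⟩ => ⟨v.1, v.2, hv, hy, hw⟩⟩

namespace RatVec.HasValue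

theorem zero (ω : Fin r → ℂ) : HasValue ω (1, 0) 0 := ⟨one_pos, by simp⟩

theorem add {v v' : RatVec r} {w w' : ℂ} (h : v.HasValue ω w) (h' : v'.HasValue ω w') :
    (v.add v').HasValue ω (w + w') := by
  obtain ⟨hv, rfl⟩ := h
  obtain ⟨hv', rfl⟩ := h'
  refine ⟨Nat.mul_pos hv hv', ?_⟩
  simp only [RatVec.add]
  push_cast
  rw [div_add_div _ _ (by exact_mod_cast hv.ne') (by exact_mod_cast hv'.ne'), Finset.sum_mul,
    Finset.mul_sum, ← Finset.sum_add_distrib]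
  congr 1
  exact Finset.sum_congr rfl fun i _ => by ring

theorem foldl_add {β : Type*} {f : β → RatVec r} {g : β → ℂ} (l : List β)
    (h : ∀ b ∈ l, (f b).HasValue ω (g b)) {v : RatVec r} {w : ℂ} (hv : v.HasValue ω w) :
    ((l.map f).foldl RatVec.add v).HasValue ω (w + (l.map g).sum) := by
  induction l generalizing v w with
  | nil => simpa using hv
  | cons b l ih =>
    rw [List.map_cons, List.map_cons, List.sum_cons, ← add_assoc]
    exact ih (fun c hc => h c (List.mem_cons_of_mem b hc)) (hv.add (h b List.mem_cons_self))

theorem sum {β : Type*} {f : β → RatVec r} {g : β → ℂ} {l : List β}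
    (h : ∀ b ∈ l, (f b).HasValue ω (g b)) :
    (RatVec.sum (l.map f)).HasValue ω (l.map g).sum := by
  simpa [RatVec.sum] using foldl_add l h (zero ω)

theorem appAll {mat : ℂ → RatMat r} {l : List ℂ} (hmat : ∀ a ∈ l, (mat a).IsMul ω a)
    {v : RatVec r} {w : ℂ} (hv : v.HasValue ω w) :
    (RatMat.appAll (l.map mat) v).HasValue ω (l.prod * w) := by
  induction l generalizing v w with
  | nil => simpa [RatMat.appAll] using hv
  | cons a l ih =>
    rw [List.prod_cons, mul_comm a, mul_assoc]
    exact ih (fun b hb => hmat b (List.mem_cons_of_mem a hb)) (hmat a List.mem_cons_self v w hv)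

theorem half {v : RatVec r} {w : ℂ} (hv : v.HasValue ω w) : v.half.HasValue ω (w / 2) := by
  obtain ⟨hpos, rfl⟩ := hv
  refine ⟨by simp only [RatVec.half, Nat.bit_false_apply]; omega, ?_⟩
  simp only [RatVec.half, Nat.bit_false_apply]
  push_cast
  rw [div_div, mul_comm]

theorem half_iterate {v : RatVec r} {w : ℂ} (hv : v.HasValue ω w) (n : ℕ) :
    (RatVec.half^[n] v).HasValue ω (w / 2 ^ n) := by
  induction n with
  | zero => simpa using hv
  | succ n ih =>
    rw [Function.iterate_succ_apply', pow_succ, ← div_div]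
    exact ih.half

end RatVec.HasValue

theorem exists_nat_mul_eq_intCast {ι : Type*} [Finite ι] (c : ι → ℚ) :
    ∃ q : ℕ, 0 < q ∧ ∀ i, ∃ z : ℤ, (z : ℚ) = q * c i := by
  have := Fintype.ofFinite ι
  refine ⟨∏ i, (c i).den, Finset.prod_pos fun i _ => (c i).den_pos, fun i => ?_⟩
  obtain ⟨t, ht⟩ := Finset.dvd_prod_of_mem (fun i => (c i).den) (Finset.mem_univ i)
  refine ⟨t * (c i).num, ?_⟩
  rw [ht, mul_comm _ t, Nat.cast_mul, mul_assoc, Rat.den_mul_eq_num]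
  push_cast
  rfl

theorem RatMat.isMul_of_basis {q : ℕ} {z : Fin r → Fin r → ℤ} {α : ℂ} (hq : 0 < q)
    (hz : ∀ j, ∑ i, (z i j : ℂ) * ω i = q * (α * ω j)) : RatMat.IsMul ω (q, z) α := by
  rintro v _ ⟨hv, rfl⟩
  refine ⟨Nat.mul_pos hq hv, ?_⟩
  have hsum : ∑ i, (∑ j, (z i j : ℂ) * v.2 j) * ω i = q * (α * ∑ j, (v.2 j : ℂ) * ω j) := by
    calc ∑ i, (∑ j, (z i j : ℂ) * v.2 j) * ω i
        = ∑ j, v.2 j * ∑ i, (z i j : ℂ) * ω i := by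
          simp only [Finset.sum_mul, Finset.mul_sum]
          rw [Finset.sum_comm]
          exact Finset.sum_congr rfl fun j _ => Finset.sum_congr rfl fun i _ => by ring
      _ = q * (α * ∑ j, (v.2 j : ℂ) * ω j) := by
          simp only [hz, Finset.mul_sum]
          exact Finset.sum_congr rfl fun j _ => by ring
  simp only [RatMat.app]
  push_cast
  rw [hsum, mul_div_mul_left _ _ (by exact_mod_cast hq.ne'), mul_div_assoc]

theorem IsValueBasis.exists_isMul {F : Set BoolFn} (hω : IsValueBasis F ω) {α : ℂ}
    (hα : α ∈ valueField F) : ∃ M : RatMat r, M.IsMul ω α := by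
  have hcoord (j) : ∃ c : Fin r → ℚ, ∑ i, c i • ω i = α * ω j :=
    (Submodule.mem_span_range_iff_exists_fun ℚ).1 ((hω.2 _).2
      (mul_mem hα ((hω.2 _).1 (Submodule.subset_span ⟨j, rfl⟩))))
  choose c hc using hcoord
  obtain ⟨q, hq, hq_int⟩ := exists_nat_mul_eq_intCast fun p : Fin r × Fin r => c p.2 p.1
  choose z hz using hq_int
  refine ⟨(q, fun i j => z (i, j)), RatMat.isMul_of_basis hq fun j => ?_⟩
  rw [← hc j, Finset.mul_sum]
  refine Finset.sum_congr rfl fun i _ => ?_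
  have hz' : (z (i, j) : ℂ) = q * c j i := by exact_mod_cast congrArg (Rat.cast : ℚ → ℂ) (hz (i, j))
  rw [hz', Rat.smul_def, mul_assoc]

end RatVec

/-! ### Forcing the alternating assignment of a path -/

/-- The edges of the path on `0, …, 2 * m`, oriented from the even to the odd vertices. -/
def pathEdges (m : ℕ) : List (Fin (m + m + 1) × Fin (m + m + 1)) :=
  ((List.finRange m).map fun b => (⟨b + b, by omega⟩, ⟨b + b + 1, by omega⟩)) ++
    (List.finRange m).map fun b => (⟨b + b + 1 + 1, by omega⟩, ⟨b + b + 1, by omega⟩)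

/-- The product of the values of the weight `R` on all edges of the path, under the assignment
`a`. -/
def pathWeight {R : Type*} [CommSemiring R] (w : Bool → Bool → R) {m : ℕ}
    (a : Fin (m + m + 1) → Bool) : R :=
  ((pathEdges m).map fun e => w (a e.1) (a e.2)).prod

/-- The assignment of the path which is `0` at the even and `1` at the odd vertices. -/
def alt (m : ℕ) (k : Fin (m + m + 1)) : Bool := decide (k.val % 2 = 1)

theorem length_pathEdges (m : ℕ) : (pathEdges m).length = m + m := by simp [pathEdges]

theorem mem_pathEdges {m : ℕ} {e : Fin (m + m + 1) × Fin (m + m + 1)} :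
    e ∈ pathEdges m ↔ ∃ b < m, (e.1.val = b + b ∨ e.1.val = b + b + 2) ∧ e.2.val = b + b + 1 := by
  obtain ⟨u, v⟩ := e
  simp only [pathEdges, List.mem_append, List.mem_map, List.mem_finRange, true_and, Prod.mk.injEq,
    Fin.ext_iff]
  constructor
  · rintro (⟨b, hu, hv⟩ | ⟨b, hu, hv⟩)
    · exact ⟨b, b.2, Or.inl hu.symm, hv.symm⟩
    · exact ⟨b, b.2, Or.inr hu.symm, hv.symm⟩
  · rintro ⟨b, hb, hu | hu, hv⟩
    · exact Or.inl ⟨⟨b, hb⟩, hu.symm, hv.symm⟩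
    · exact Or.inr ⟨⟨b, hb⟩, hu.symm, hv.symm⟩

theorem alt_of_mem_pathEdges {m : ℕ} {e : Fin (m + m + 1) × Fin (m + m + 1)}
    (he : e ∈ pathEdges m) : alt m e.1 = false ∧ alt m e.2 = true := by
  obtain ⟨b, _, hu, hv⟩ := mem_pathEdges.1 he
  simp only [alt, decide_eq_false_iff_not, decide_eq_true_eq]
  omega

theorem alt_ne_not_alt (m : ℕ) : alt m ≠ fun k => !alt m k := fun h => by
  simpa using congrFun h 0

theorem eq_alt_or_eq_not_alt {m : ℕ} {a : Fin (m + m + 1) → Bool}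
    (ha : ∀ e ∈ pathEdges m, a e.1 ≠ a e.2) : a = alt m ∨ a = fun k => !alt m k := by
  have hstep (k : ℕ) (hk : k + 1 < m + m + 1) : a ⟨k + 1, hk⟩ = !a ⟨k, by omega⟩ := by
    rcases Nat.even_or_odd' k with ⟨b, rfl | rfl⟩
    · exact Bool.eq_not.2 (ha (⟨2 * b, by omega⟩, ⟨2 * b + 1, hk⟩)
        (mem_pathEdges.2 ⟨b, by omega, Or.inl (two_mul b), by simp [two_mul]⟩)).symm
    · exact Bool.eq_not.2 (ha (⟨2 * b + 1 + 1, hk⟩, ⟨2 * b + 1, by omega⟩)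
        (mem_pathEdges.2 ⟨b, by omega, Or.inr (by simp [two_mul]), by simp [two_mul]⟩))
  have hall (k : ℕ) (hk : k < m + m + 1) : a ⟨k, hk⟩ = Bool.xor (a 0) (alt m ⟨k, hk⟩) := by
    induction k with
    | zero => simp [alt]
    | succ k ih =>
      have halt : alt m ⟨k + 1, hk⟩ = !alt m ⟨k, by omega⟩ := by
        rw [Bool.eq_not]
        simp only [alt, ne_eq, decide_eq_decide]
        omega
      rw [hstep k hk, ih (by omega), halt, Bool.xor_not]
  cases h : a 0
  · exact Or.inl (funext fun k => by rw [hall k k.2, h, Bool.false_xor])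
  · exact Or.inr (funext fun k => by rw [hall k k.2, h, Bool.true_xor])

section PathWeight

variable {R : Type*} [CommSemiring R] {w : Bool → Bool → R}

theorem pathWeight_eq_one {m : ℕ} {a : Fin (m + m + 1) → Bool}
    (h : ∀ e ∈ pathEdges m, w (a e.1) (a e.2) = 1) : pathWeight w a = 1 :=
  List.prod_eq_one fun x hx => by
    obtain ⟨e, he, rfl⟩ := List.mem_map.1 hx
    exact h e he

theorem pathWeight_eq_zero {m : ℕ} {a : Fin (m + m + 1) → Bool}
    {e : Fin (m + m + 1) × Fin (m + m + 1)} (he : e ∈ pathEdges m) (h : w (a e.1) (a e.2) = 0) :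
    pathWeight w a = 0 :=
  List.prod_eq_zero (List.mem_map.2 ⟨e, he, h⟩)

theorem pathWeight_alt (h : w false true = 1) (m : ℕ) : pathWeight w (alt m) = 1 :=
  pathWeight_eq_one fun e he => by rw [(alt_of_mem_pathEdges he).1, (alt_of_mem_pathEdges he).2, h]

theorem pathWeight_not_alt (h : w true false = 1) (m : ℕ) :
    pathWeight w (fun k => !alt m k) = 1 :=
  pathWeight_eq_one fun e he => by
    rw [(alt_of_mem_pathEdges he).1, (alt_of_mem_pathEdges he).2]
    exact h

theorem pathWeight_not_alt_eq_zero (h : w true false = 0) {m : ℕ} (hm : 0 < m) :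
    pathWeight w (fun k => !alt m k) = 0 :=
  pathWeight_eq_zero (e := (⟨0, by omega⟩, ⟨1, by omega⟩))
    (mem_pathEdges.2 ⟨0, hm, by simp⟩) (by simpa [alt] using h)

theorem eq_alt_or_eq_not_alt_of_pathWeight_ne_zero (h₀ : w false false = 0)
    (h₁ : w true true = 0) {m : ℕ} {a : Fin (m + m + 1) → Bool} (ha : pathWeight w a ≠ 0) :
    a = alt m ∨ a = fun k => !alt m k := by
  refine eq_alt_or_eq_not_alt fun e he heq => ha (pathWeight_eq_zero he ?_)
  rw [heq]
  cases a e.2 <;> assumption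

theorem sum_pathWeight (h₀ : w false false = 0) (h₁ : w true true = 0) (m : ℕ) :
    ∑ a : Fin (m + m + 1) → Bool, pathWeight w a =
      pathWeight w (alt m) + pathWeight w fun k => !alt m k := by
  rw [← Finset.sum_pair (alt_ne_not_alt m)]
  refine (Finset.sum_subset (Finset.subset_univ _) fun a _ ha => ?_).symm
  by_contra hne
  rcases eq_alt_or_eq_not_alt_of_pathWeight_ne_zero h₀ h₁ hne with h | h <;> simp [h] at ha

end PathWeight

/-! ### Binomials that force the alternating assignment -/

/-- A function in `F` whose arguments are identified with one of two variables, according to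
`pattern`. -/
structure Gadget (F : Set BoolFn) where
  fn : BoolFn
  mem : fn ∈ F
  pattern : Fin fn.arity → Bool

/-- All functions in `F` are invariant under complementing their argument. -/
def ComplInvariant (F : Set BoolFn) : Prop :=
  ∀ f ∈ F, ∀ x, f.toFun (fun j => !x j) = f.toFun x

/-- The product of the values of the constraints in `l`. -/
noncomputable def evalAll {F : Set BoolFn} {n : ℕ} (l : List (Cstr F n)) (σ : Fin n → Bool) : ℂ :=
  (l.map fun c => c.fn.toFun fun j => σ (c.vars j)).prod

section Gadget

variable {F : Set BoolFn}

/-- The binary function defined by a gadget. -/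
def Gadget.val (g : Gadget F) (x y : Bool) : ℂ := g.fn.toFun fun j => if g.pattern j then y else x

/-- The product of the values of the binomials in `S` on an edge whose vertices have the values
`x` and `y`. -/
noncomputable def edgeWeight (S : List (Binomial ℂ (Gadget F))) (x y : Bool) : ℂ :=
  (S.map (Binomial.eval fun g => g.val x y)).prod

/-- The binomials in `S` can replace pins: on the edges of a path, they force an assignment which
the constraints over `F` cannot distinguish from the alternating one, with total weight `2 ^ k`. -/
structure IsPinning (F : Set BoolFn) (S : List (Binomial ℂ (Gadget F))) (k : ℕ) : Prop where
  coeff : ∀ s ∈ S, s.1.1 ∈ valueField F ∧ s.1.2 ∈ valueField F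
  sum_eq : ∀ m, 0 < m → ∑ a : Fin (m + m + 1) → Bool, pathWeight (edgeWeight S) a = 2 ^ k
  equiv : ∀ m, 0 < m → ∀ a : Fin (m + m + 1) → Bool, pathWeight (edgeWeight S) a ≠ 0 →
    ∀ (n : ℕ) (l : List (Cstr F n)) (g : Fin n → Fin (n + (m + m + 1))),
      ∑ τ : Fin n → Bool, evalAll l (fun v => Fin.append τ a (g v)) =
        ∑ τ : Fin n → Bool, evalAll l (fun v => Fin.append τ (alt m) (g v))

theorem toFun_mem_valueField {f : BoolFn} (hf : f ∈ F) (x : Fin f.arity → Bool) :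
    f.toFun x ∈ valueField F :=
  IntermediateField.subset_adjoin ℚ _ ⟨f, hf, x, rfl⟩

namespace Gadget

theorem val_mem_valueField (g : Gadget F) (x y : Bool) : g.val x y ∈ valueField F :=
  toFun_mem_valueField g.mem _

theorem val_self (g : Gadget F) (x : Bool) : g.val x x = g.fn.toFun fun _ => x := by
  simp only [val, ite_self]

theorem val_false_true (g : Gadget F) : g.val false true = g.fn.toFun g.pattern := by
  simp only [val, Bool.if_false_right, Bool.decide_eq_true, Bool.and_true]

theorem val_true_false (g : Gadget F) : g.val true false = g.fn.toFun fun j => !g.pattern j := by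
  simp only [val]
  congr 1
  funext j
  cases g.pattern j <;> rfl

/-- The affine function of the value of `g` which is `1` at `(0, 1)` and `0` at `(x, y)`. If `g`
has the same value at these two points, then the function vanishes identically. -/
noncomputable def sep (g : Gadget F) (x y : Bool) : Binomial ℂ (Gadget F) :=
  (((g.val false true - g.val x y)⁻¹, -g.val x y * (g.val false true - g.val x y)⁻¹), [g])

theorem sep_mem_valueField (g : Gadget F) (x y : Bool) :
    (g.sep x y).1.1 ∈ valueField F ∧ (g.sep x y).1.2 ∈ valueField F := by
  have hinv := inv_mem (sub_mem (g.val_mem_valueField false true) (g.val_mem_valueField x y))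
  exact ⟨hinv, mul_mem (neg_mem (g.val_mem_valueField x y)) hinv⟩

theorem eval_sep_self (g : Gadget F) (x y : Bool) :
    (g.sep x y).eval (fun g => g.val x y) = 0 := by
  simp only [sep, Binomial.eval, List.map_cons, List.map_nil, List.prod_singleton]
  ring

theorem eval_sep_false_true {g : Gadget F} {x y : Bool} (h : g.val false true ≠ g.val x y) :
    (g.sep x y).eval (fun g => g.val false true) = 1 := by
  rw [← mul_inv_cancel₀ (sub_ne_zero.2 h)]
  simp only [sep, Binomial.eval, List.map_cons, List.map_nil, List.prod_singleton]
  ring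

end Gadget

theorem edgeWeight_eq_zero {S : List (Binomial ℂ (Gadget F))} {g : Gadget F} {x y : Bool}
    (hg : g.sep x y ∈ S) : edgeWeight S x y = 0 :=
  List.prod_eq_zero (List.mem_map.2 ⟨_, hg, g.eval_sep_self x y⟩)

theorem edgeWeight_false_true {S : List (Binomial ℂ (Gadget F))}
    (hS : ∀ s ∈ S, s.eval (fun g => g.val false true) = 1) : edgeWeight S false true = 1 :=
  List.prod_eq_one fun x hx => by
    obtain ⟨s, hs, rfl⟩ := List.mem_map.1 hx
    exact hS s hs

theorem ComplInvariant.edgeWeight_true_false (hF : ComplInvariant F)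
    (S : List (Binomial ℂ (Gadget F))) : edgeWeight S true false = edgeWeight S false true := by
  have hval : (fun g : Gadget F => g.val true false) = fun g => g.val false true :=
    funext fun g => by rw [g.val_true_false, g.val_false_true, hF g.fn g.mem]
  rw [edgeWeight, hval, edgeWeight]

theorem ComplInvariant.evalAll_not (hF : ComplInvariant F) {n : ℕ} (l : List (Cstr F n))
    (σ : Fin n → Bool) : evalAll l (fun v => !σ v) = evalAll l σ := by
  unfold evalAll
  congr 1
  exact List.map_congr_left fun c _ => hF c.fn c.mem _

theorem sum_comp_not {M : Type*} [AddCommMonoid M] {n : ℕ} (G : (Fin n → Bool) → M) :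
    ∑ τ : Fin n → Bool, G (fun v => !τ v) = ∑ τ, G τ :=
  Fintype.sum_equiv (Equiv.arrowCongr (Equiv.refl _) Equiv.boolNot) _ _ fun _ => rfl

theorem append_not_not {n m : ℕ} (τ : Fin n → Bool) (a : Fin m → Bool) (v : Fin (n + m)) :
    Fin.append (fun v => !τ v) (fun k => !a k) v = !Fin.append τ a v := by
  refine Fin.addCases (fun v => ?_) (fun v => ?_) v <;> simp

theorem isPinning_of_eq_zero {S : List (Binomial ℂ (Gadget F))}
    (hcoeff : ∀ s ∈ S, s.1.1 ∈ valueField F ∧ s.1.2 ∈ valueField F)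
    (h₀₀ : edgeWeight S false false = 0) (h₁₁ : edgeWeight S true true = 0)
    (h₀₁ : edgeWeight S false true = 1) (h₁₀ : edgeWeight S true false = 0) :
    IsPinning F S 0 where
  coeff := hcoeff
  sum_eq m hm := by
    rw [sum_pathWeight h₀₀ h₁₁, pathWeight_alt h₀₁, pathWeight_not_alt_eq_zero h₁₀ hm, add_zero,
      pow_zero]
  equiv m hm a ha n l g := by
    rcases eq_alt_or_eq_not_alt_of_pathWeight_ne_zero h₀₀ h₁₁ ha with rfl | rfl
    · rfl
    · exact absurd (pathWeight_not_alt_eq_zero h₁₀ hm) ha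

theorem ComplInvariant.isPinning (hF : ComplInvariant F) {S : List (Binomial ℂ (Gadget F))}
    (hcoeff : ∀ s ∈ S, s.1.1 ∈ valueField F ∧ s.1.2 ∈ valueField F)
    (h₀₀ : edgeWeight S false false = 0) (h₁₁ : edgeWeight S true true = 0)
    (h₀₁ : edgeWeight S false true = 1) : IsPinning F S 1 where
  coeff := hcoeff
  sum_eq m _ := by
    rw [sum_pathWeight h₀₀ h₁₁, pathWeight_alt h₀₁,
      pathWeight_not_alt ((hF.edgeWeight_true_false S).trans h₀₁), one_add_one_eq_two, pow_one]
  equiv m _ a ha n l g := by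
    rcases eq_alt_or_eq_not_alt_of_pathWeight_ne_zero h₀₀ h₁₁ ha with rfl | rfl
    · rfl
    · rw [← sum_comp_not]
      simp only [append_not_not, hF.evalAll_not]

/-- If all functions are constant, nothing can be forced and nothing needs to be: the binomial
`1 / 2` only compensates for the number of assignments of the path. -/
theorem isPinning_of_forall_eq (h : ∀ f ∈ F, ∀ x y, f.toFun x = f.toFun y) :
    IsPinning F [((1 / 2, 0), [])] 1 where
  coeff s hs := by
    rw [List.mem_singleton.1 hs]
    exact ⟨div_mem (one_mem _) (ofNat_mem _ 2), zero_mem _⟩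
  sum_eq m _ := by
    have hweight (a : Fin (m + m + 1) → Bool) :
        pathWeight (edgeWeight ([((1 / 2, 0), [])] : List (Binomial ℂ (Gadget F)))) a =
          (1 / 2) ^ (m + m) := by
      simp [pathWeight, edgeWeight, Binomial.eval, length_pathEdges]
    simp only [hweight, Finset.sum_const, Finset.card_univ, Fintype.card_fun, Fintype.card_bool,
      Fintype.card_fin, nsmul_eq_mul]
    push_cast
    rw [pow_succ, mul_right_comm, ← mul_pow]
    norm_num
  equiv m _ a _ n l g := by
    refine Finset.sum_congr rfl fun τ _ => ?_
    unfold evalAll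
    congr 1
    exact List.map_congr_left fun c _ => h c.fn c.mem _ _

theorem exists_gadget_val_ne {f : BoolFn} (hf : f ∈ F) {x y : Fin f.arity → Bool}
    (hxy : f.toFun x ≠ f.toFun y) (b : Bool) : ∃ g : Gadget F, g.val false true ≠ g.val b b := by
  by_contra! h
  have hconst (z) : f.toFun z = f.toFun fun _ => b := by
    simpa only [Gadget.val_false_true, Gadget.val_self] using h ⟨f, hf, z⟩
  exact hxy ((hconst x).trans (hconst y).symm)

theorem exists_gadget_val_ne_of_not_complInvariant (hF : ¬ComplInvariant F) :
    ∃ g : Gadget F, g.val false true ≠ g.val true false := by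
  unfold ComplInvariant at hF
  push Not at hF
  obtain ⟨f, hf, z, hz⟩ := hF
  refine ⟨⟨f, hf, z⟩, ?_⟩
  rw [Gadget.val_false_true, Gadget.val_true_false]
  exact hz.symm

theorem exists_isPinning (F : Set BoolFn) : ∃ S k, IsPinning F S k := by
  by_cases hconst : ∀ f ∈ F, ∀ x y, f.toFun x = f.toFun y
  · exact ⟨_, _, isPinning_of_forall_eq hconst⟩
  push Not at hconst
  obtain ⟨f, hf, x, y, hxy⟩ := hconst
  obtain ⟨g₀, hg₀⟩ := exists_gadget_val_ne hf hxy false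
  obtain ⟨g₁, hg₁⟩ := exists_gadget_val_ne hf hxy true
  by_cases hF : ComplInvariant F
  · refine ⟨[g₀.sep false false, g₁.sep true true], 1, hF.isPinning ?_
      (edgeWeight_eq_zero (g := g₀) (by simp)) (edgeWeight_eq_zero (g := g₁) (by simp))
      (edgeWeight_false_true ?_)⟩
    · simp [Gadget.sep_mem_valueField]
    · simp [Gadget.eval_sep_false_true, hg₀, hg₁]
  · obtain ⟨g₂, hg₂⟩ := exists_gadget_val_ne_of_not_complInvariant hF
    refine ⟨[g₀.sep false false, g₁.sep true true, g₂.sep true false], 0, isPinning_of_eq_zero ?_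
      (edgeWeight_eq_zero (g := g₀) (by simp)) (edgeWeight_eq_zero (g := g₁) (by simp))
      (edgeWeight_false_true ?_) (edgeWeight_eq_zero (g := g₂) (by simp))⟩
    · simp [Gadget.sep_mem_valueField]
    · simp [Gadget.eval_sep_false_true, hg₀, hg₁, hg₂]

end Gadget

/-! ### Pins -/

/-- The pin to `b`: `delta0` and `delta1` in a form that allows them to be treated together. -/
def delta (b : Bool) : BoolFn := ⟨1, fun x => if x 0 = b then 1 else 0⟩

theorem delta_injective : Function.Injective delta := fun b b' h => by
  have hval := congrArg (fun f : BoolFn => f.toFun fun _ => b) h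
  simpa [delta] using hval

theorem mem_of_forall_ne_delta {F : Set BoolFn} {f : BoolFn} (hf : f ∈ F ∪ {delta0, delta1})
    (hne : ∀ b, f ≠ delta b) : f ∈ F :=
  hf.resolve_right fun h => h.elim (hne false) (hne true)

namespace Cstr

variable {F : Set BoolFn} {n : ℕ}

theorem toFun_of_delta {c : Cstr F n} {b : Bool} (hc : c.fn = delta b) {τ : Fin n → Bool}
    (h : ∀ j, τ (c.vars j) = b) : (c.fn.toFun fun j => τ (c.vars j)) = 1 := by
  obtain ⟨f, hf, vars⟩ := c
  subst hc
  exact if_pos (h _)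

theorem toFun_of_delta_eq_zero {c : Cstr F n} {b : Bool} (hc : c.fn = delta b) {τ : Fin n → Bool}
    {j : Fin c.fn.arity} (h : τ (c.vars j) ≠ b) : (c.fn.toFun fun j => τ (c.vars j)) = 0 := by
  obtain ⟨f, hf, vars⟩ := c
  subst hc
  rw [Subsingleton.elim (α := Fin 1) j 0] at h
  exact if_neg h

/-- The constraint `c` as one over `F`, unless it is a pin. -/
noncomputable def unpin (c : Cstr (F ∪ {delta0, delta1}) n) : Option (Cstr F n) :=
  open Classical in
  if h : ∀ b, c.fn ≠ delta b then some ⟨c.fn, mem_of_forall_ne_delta c.mem h, c.vars⟩ else none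

/-- The constraint that arises from `c` if the variables are replaced according to `g`. -/
def mapVars {m : ℕ} (g : Fin n → Fin m) (c : Cstr F n) : Cstr F m :=
  ⟨c.fn, c.mem, fun j => g (c.vars j)⟩

theorem unpin_of_delta {c : Cstr (F ∪ {delta0, delta1}) n} {b : Bool} (hc : c.fn = delta b) :
    c.unpin = none :=
  dif_neg fun h => h b hc

theorem unpin_of_forall_ne {c : Cstr (F ∪ {delta0, delta1}) n} (hc : ∀ b, c.fn ≠ delta b) :
    c.unpin = some ⟨c.fn, mem_of_forall_ne_delta c.mem hc, c.vars⟩ :=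
  dif_pos hc

end Cstr

section Pins

variable {F : Set BoolFn} {n : ℕ} {l : List (Cstr (F ∪ {delta0, delta1}) n)}

/-- The constraints in `l` other than pins. -/
noncomputable def unpinned (l : List (Cstr (F ∪ {delta0, delta1}) n)) : List (Cstr F n) :=
  l.filterMap Cstr.unpin

/-- The variable `v` is pinned to `b` by a constraint in `l`. -/
def IsPinned (l : List (Cstr F n)) (b : Bool) (v : Fin n) : Prop :=
  ∃ c ∈ l, c.fn = delta b ∧ ∃ j, c.vars j = v

/-- The assignment `τ` satisfies all pins in `l`. -/
def RespectsPins (l : List (Cstr F n)) (τ : Fin n → Bool) : Prop :=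
  ∀ v b, IsPinned l b v → τ v = b

open Classical in
/-- The value to which the variable `v` is pinned by `l`; the choice made for a variable which is
pinned to both values is that of the reduction. -/
noncomputable def pinValue (l : List (Cstr F n)) (v : Fin n) : Bool := !decide (IsPinned l false v)

theorem unpinned_cons_of_delta {c : Cstr (F ∪ {delta0, delta1}) n} {b : Bool}
    (hc : c.fn = delta b) : unpinned (c :: l) = unpinned l :=
  List.filterMap_cons_none (Cstr.unpin_of_delta hc)

theorem unpinned_cons_of_forall_ne {c : Cstr (F ∪ {delta0, delta1}) n}
    (hc : ∀ b, c.fn ≠ delta b) :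
    unpinned (c :: l) = ⟨c.fn, mem_of_forall_ne_delta c.mem hc, c.vars⟩ :: unpinned l :=
  List.filterMap_cons_some (Cstr.unpin_of_forall_ne hc)

theorem evalAll_cons (c : Cstr F n) (l : List (Cstr F n)) (τ : Fin n → Bool) :
    evalAll (c :: l) τ = (c.fn.toFun fun j => τ (c.vars j)) * evalAll l τ :=
  List.prod_cons

theorem evalAll_map_mapVars {m : ℕ} (g : Fin n → Fin m) (l : List (Cstr F n)) (σ : Fin m → Bool) :
    evalAll (l.map (Cstr.mapVars g)) σ = evalAll l fun v => σ (g v) := by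
  simp only [evalAll, List.map_map]
  rfl

theorem evalAll_unpinned {τ : Fin n → Bool} (hτ : RespectsPins l τ) :
    evalAll (unpinned l) τ = evalAll l τ := by
  induction l with
  | nil => rfl
  | cons c l ih =>
    have hl : RespectsPins l τ := fun v b ⟨c', hc', h⟩ =>
      hτ v b ⟨c', List.mem_cons_of_mem c hc', h⟩
    by_cases hc : ∀ b, c.fn ≠ delta b
    · rw [unpinned_cons_of_forall_ne hc, evalAll_cons, evalAll_cons, ih hl]
    · push Not at hc
      obtain ⟨b, hb⟩ := hc
      have hone := Cstr.toFun_of_delta hb fun j => hτ _ b ⟨c, List.mem_cons_self, hb, j, rfl⟩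
      rw [unpinned_cons_of_delta hb, evalAll_cons, hone, one_mul, ih hl]

theorem evalAll_eq_zero {l : List (Cstr F n)} {τ : Fin n → Bool} (hτ : ¬RespectsPins l τ) :
    evalAll l τ = 0 := by
  unfold RespectsPins at hτ
  push Not at hτ
  obtain ⟨_, b, ⟨c, hc, hb, j, rfl⟩, hne⟩ := hτ
  exact List.prod_eq_zero (List.mem_map.2 ⟨c, hc, Cstr.toFun_of_delta_eq_zero hb hne⟩)

theorem value_eq_zero_of_isPinned {I : Inst F} {v : Fin I.numVars}
    (h₀ : IsPinned I.cstrs false v) (h₁ : IsPinned I.cstrs true v) : I.value = 0 :=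
  Finset.sum_eq_zero fun _ _ => evalAll_eq_zero fun h =>
    Bool.false_ne_true ((h v false h₀).symm.trans (h v true h₁))

theorem respectsPins_iff {l : List (Cstr F n)} {τ : Fin n → Bool}
    (hl : ∀ v, ¬(IsPinned l false v ∧ IsPinned l true v)) :
    RespectsPins l τ ↔ ∀ v, (∃ b, IsPinned l b v) → τ v = pinValue l v := by
  have hvalue {v b} (hb : IsPinned l b v) : pinValue l v = b := by
    cases b
    · simp [pinValue, hb]
    · simpa [pinValue] using fun h => hl v ⟨h, hb⟩
  constructor
  · rintro h v ⟨b, hb⟩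
    rw [h v b hb, hvalue hb]
  · intro h v b hb
    rw [h v ⟨b, hb⟩, hvalue hb]

theorem sum_override {M : Type*} [Semiring M] (p : Fin n → Prop) [DecidablePred p]
    (c : Fin n → Bool) (G : (Fin n → Bool) → M) :
    ∑ τ : Fin n → Bool, G (fun v => if p v then c v else τ v) =
      2 ^ Fintype.card {v // p v} *
        ∑ τ : Fin n → Bool, if ∀ v, p v → τ v = c v then G τ else 0 := by
  let e := Equiv.piEquivPiSubtypeProd p fun _ => Bool
  have hoverride u w : (fun v => if p v then c v else e.symm (u, w) v) =
      e.symm (fun v => c v, w) := by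
    funext v
    by_cases hv : p v <;> simp [e, Equiv.piEquivPiSubtypeProd, hv]
  have hagree u w : (∀ v, p v → e.symm (u, w) v = c v) ↔ u = fun v : {v // p v} => c v := by
    simp +contextual [e, Equiv.piEquivPiSubtypeProd, funext_iff]
  rw [← e.symm.sum_comp, ← e.symm.sum_comp, Fintype.sum_prod_type, Fintype.sum_prod_type]
  simp only [hoverride, hagree]
  rw [Finset.sum_const, Finset.card_univ, Fintype.card_fun, Fintype.card_bool, nsmul_eq_mul,
    Nat.cast_pow, Nat.cast_ofNat]
  congr 1
  rw [Finset.sum_eq_single (fun v : {v // p v} => c v) (fun u _ hu => by simp [hu]) (by simp)]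
  simp

end Pins

/-! ### Replacing the pins by a path -/

/-- The vertex of the path that belongs to the block of `v` and has the value `b` in the
alternating assignment. -/
def pathVertex (d : ℕ) {n : ℕ} (v : Fin n) (b : Bool) :
    Fin (numBlocks d n + numBlocks d n + 1) :=
  ⟨v / d + v / d + b.toNat, by
    have hblock : v / d ≤ n / d := Nat.div_le_div_right v.2.le
    have hb := b.toNat_le
    unfold numBlocks
    omega⟩

theorem alt_pathVertex (d : ℕ) {n : ℕ} (v : Fin n) (b : Bool) : alt _ (pathVertex d v b) = b := by
  simp only [alt, pathVertex]
  cases b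
  · exact decide_eq_false (by rw [Bool.toNat_false]; omega)
  · exact decide_eq_true (by rw [Bool.toNat_true]; omega)

theorem div_eq_of_pathVertex_eq {d n : ℕ} {v v' : Fin n} {b b' : Bool}
    (h : pathVertex d v b = pathVertex d v' b') : (v : ℕ) / d = v' / d := by
  have hval := congrArg Fin.val h
  have hb := b.toNat_le
  have hb' := b'.toNat_le
  simp only [pathVertex] at hval
  omega

section Path

variable {F : Set BoolFn} {n : ℕ}

/-- The constraint on the variables `u` and `v` that the gadget `g` stands for. -/
def Gadget.onEdge {N : ℕ} (e : Fin N × Fin N) (g : Gadget F) : Cstr F N :=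
  ⟨g.fn, g.mem, fun j => if g.pattern j then e.2 else e.1⟩

/-- The binomials in `S` on all edges of a path that is appended to `n` variables. -/
def pathBinomials (S : List (Binomial ℂ (Gadget F))) (n m : ℕ) :
    List (Binomial ℂ (Cstr F (n + (m + m + 1)))) :=
  (pathEdges m).flatMap fun e =>
    S.map (Binomial.map id (Gadget.onEdge (Fin.natAdd n e.1, Fin.natAdd n e.2)))

open Classical in
/-- The variable that replaces `v`: if `v` is pinned, a vertex of the path, as in
`NamedInst.substVar`. -/
noncomputable def substVar (l : List (Cstr (F ∪ {delta0, delta1}) n)) (d : ℕ) (v : Fin n) :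
    Fin (n + (numBlocks d n + numBlocks d n + 1)) :=
  if ∃ b, IsPinned l b v then Fin.natAdd n (pathVertex d v (pinValue l v)) else Fin.castAdd _ v

/-- The constraints other than pins, after the pinned variables have been replaced. -/
noncomputable def residual (l : List (Cstr (F ∪ {delta0, delta1}) n)) (d : ℕ) :
    List (Cstr F (n + (numBlocks d n + numBlocks d n + 1))) :=
  (unpinned l).map (Cstr.mapVars (substVar l d))

/-- The terms into which the reduction expands the constraints in `l`. -/
noncomputable def terms (S : List (Binomial ℂ (Gadget F))) (d : ℕ)
    (l : List (Cstr (F ∪ {delta0, delta1}) n)) :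
    List (List ℂ × List (Cstr F (n + (numBlocks d n + numBlocks d n + 1)))) :=
  expand (pathBinomials S n (numBlocks d n)) (residual l d)

theorem prod_eval_pathBinomials (S : List (Binomial ℂ (Gadget F))) {m : ℕ} (τ : Fin n → Bool)
    (a : Fin (m + m + 1) → Bool) :
    ((pathBinomials S n m).map
      (Binomial.eval fun c => c.fn.toFun fun j => Fin.append τ a (c.vars j))).prod =
        pathWeight (edgeWeight S) a := by
  rw [pathBinomials, List.map_flatMap, List.flatMap_def, List.prod_flatten, List.map_map,
    pathWeight]
  congr 1
  refine List.map_congr_left fun e _ => ?_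
  simp only [Function.comp_apply, List.map_map, edgeWeight]
  congr 1
  refine List.map_congr_left fun s _ => ?_
  simp only [Function.comp_apply, Binomial.eval, Binomial.map, List.map_map, id]
  congr 3
  refine List.map_congr_left fun g _ => congrArg g.fn.toFun (funext fun j => ?_)
  simp only [Gadget.onEdge]
  split_ifs <;> simp

theorem append_alt_substVar (l : List (Cstr (F ∪ {delta0, delta1}) n)) (d : ℕ) (τ : Fin n → Bool)
    (v : Fin n) [Decidable (∃ b, IsPinned l b v)] :
    Fin.append τ (alt _) (substVar l d v) =
      if ∃ b, IsPinned l b v then pinValue l v else τ v := by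
  unfold substVar
  split_ifs
  · rw [Fin.append_right, alt_pathVertex]
  · rw [Fin.append_left]

theorem sum_append {M : Type*} [AddCommMonoid M] {m : ℕ} (G : (Fin (n + m) → Bool) → M) :
    ∑ σ, G σ = ∑ a : Fin m → Bool, ∑ τ : Fin n → Bool, G (Fin.append τ a) := by
  rw [← (Fin.appendEquiv n m).sum_comp, Fintype.sum_prod_type, Finset.sum_comm]
  rfl

open Classical in
theorem sum_evalAll_residual {l : List (Cstr (F ∪ {delta0, delta1}) n)} (d : ℕ)
    (hl : ∀ v, ¬(IsPinned l false v ∧ IsPinned l true v)) :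
    ∑ τ : Fin n → Bool, evalAll (residual l d) (Fin.append τ (alt _)) =
      2 ^ Fintype.card {v // ∃ b, IsPinned l b v} * ∑ τ : Fin n → Bool, evalAll l τ := by
  simp only [residual, evalAll_map_mapVars, append_alt_substVar]
  rw [sum_override]
  congr 1
  refine Finset.sum_congr rfl fun τ _ => ?_
  split_ifs with hτ
  · exact evalAll_unpinned ((respectsPins_iff hl).2 hτ)
  · exact (evalAll_eq_zero fun h => hτ ((respectsPins_iff hl).1 h)).symm

theorem IsPinning.sum_pathWeight_mul {S : List (Binomial ℂ (Gadget F))} {k : ℕ}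
    (hS : IsPinning F S k) {m : ℕ} (hm : 0 < m) (l : List (Cstr F n))
    (g : Fin n → Fin (n + (m + m + 1))) :
    ∑ a, pathWeight (edgeWeight S) a *
        ∑ τ : Fin n → Bool, evalAll l (fun v => Fin.append τ a (g v)) =
      2 ^ k * ∑ τ : Fin n → Bool, evalAll l (fun v => Fin.append τ (alt m) (g v)) := by
  rw [← hS.sum_eq m hm, Finset.sum_mul]
  refine Finset.sum_congr rfl fun a _ => ?_
  by_cases ha : pathWeight (edgeWeight S) a = 0
  · rw [ha, zero_mul, zero_mul]
  · rw [hS.equiv m hm a ha n l g]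

theorem sum_terms_eq_sum_termSum {N : ℕ} (L : List (List ℂ × List (Cstr F N))) :
    (L.map fun p => p.1.prod * (⟨N, p.2⟩ : Inst F).value).sum =
      ∑ σ : Fin N → Bool, termSum (fun c => c.fn.toFun fun j => σ (c.vars j)) L := by
  induction L with
  | nil => simp [termSum]
  | cons p L ih =>
    rw [List.map_cons, List.sum_cons, ih, Inst.value, Finset.mul_sum, ← Finset.sum_add_distrib]
    rfl

open Classical in
theorem IsPinning.sum_terms {S : List (Binomial ℂ (Gadget F))} {k : ℕ} (hS : IsPinning F S k)
    (d : ℕ) {I : Inst (F ∪ {delta0, delta1})}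
    (hI : ∀ v, ¬(IsPinned I.cstrs false v ∧ IsPinned I.cstrs true v)) :
    ((terms S d I.cstrs).map fun p => p.1.prod * (⟨_, p.2⟩ : Inst F).value).sum =
      2 ^ (Fintype.card {v // ∃ b, IsPinned I.cstrs b v} + k) * I.value := by
  set l := I.cstrs
  set m := numBlocks d I.numVars
  calc ((terms S d l).map fun p => p.1.prod * (⟨_, p.2⟩ : Inst F).value).sum
      = ∑ a : Fin (m + m + 1) → Bool, pathWeight (edgeWeight S) a *
          ∑ τ : Fin I.numVars → Bool, evalAll (residual l d) (Fin.append τ a) := by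
        rw [sum_terms_eq_sum_termSum, sum_append]
        simp only [terms, termSum_expand, prod_eval_pathBinomials, Finset.mul_sum]
        rfl
    _ = 2 ^ k * ∑ τ : Fin I.numVars → Bool, evalAll (residual l d) (Fin.append τ (alt m)) := by
        simp only [residual, evalAll_map_mapVars]
        exact hS.sum_pathWeight_mul (Nat.succ_pos _) _ _
    _ = 2 ^ (Fintype.card {v // ∃ b, IsPinned l b v} + k) * I.value := by
        rw [sum_evalAll_residual d hI, ← mul_assoc, ← pow_add, add_comm k]
        rfl

end Path

/-! ### Degrees -/

section Degree

variable {F : Set BoolFn} {n : ℕ}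

/-- The number of constraints in `l` that contain the variable `v`. -/
def degree (l : List (Cstr F n)) (v : Fin n) : ℕ := l.countP fun c => decide (∃ j, c.vars j = v)

theorem degree_cons (c : Cstr F n) (l : List (Cstr F n)) (v : Fin n) :
    degree (c :: l) v = degree l v + if ∃ j, c.vars j = v then 1 else 0 := by
  simp [degree, List.countP_cons]

theorem countP_le_sum_degree (A : Finset (Fin n)) (P : Cstr F n → Bool)
    (hP : ∀ c, P c → ∃ j, c.vars j ∈ A) (l : List (Cstr F n)) :
    l.countP P ≤ ∑ v ∈ A, degree l v := by
  induction l with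
  | nil => exact Nat.zero_le _
  | cons c l ih =>
    simp only [List.countP_cons, degree_cons, Finset.sum_add_distrib]
    refine add_le_add ih ?_
    split_ifs with hc
    · obtain ⟨j, hj⟩ := hP c hc
      exact le_of_eq_of_le (if_pos ⟨j, rfl⟩).symm (Finset.single_le_sum
        (f := fun v => if ∃ j, c.vars j = v then 1 else 0) (fun _ _ => Nat.zero_le _) hj)
    · exact Nat.zero_le _

theorem degree_map_mapVars_le {m : ℕ} (g : Fin n → Fin m) (l : List (Cstr F n)) (w : Fin m) :
    degree (l.map (Cstr.mapVars g)) w ≤ ∑ v with g v = w, degree l v := by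
  rw [degree, List.countP_map]
  refine countP_le_sum_degree _ _ (fun c hc => ?_) l
  simpa using of_decide_eq_true (p := ∃ j, g (c.vars j) = w) hc

theorem degree_unpinned_le (l : List (Cstr (F ∪ {delta0, delta1}) n)) (v : Fin n) :
    degree (unpinned l) v ≤ degree l v := by
  induction l with
  | nil => exact le_rfl
  | cons c l ih =>
    rw [degree_cons]
    by_cases hc : ∀ b, c.fn ≠ delta b
    · rw [unpinned_cons_of_forall_ne hc, degree_cons]
      exact Nat.add_le_add_right ih _
    · push Not at hc
      rw [unpinned_cons_of_delta hc.choose_spec]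
      exact Nat.le_add_right_of_le ih

theorem length_le_numVars_mul (har : ∀ f ∈ F, 0 < f.arity) {D : ℕ} {I : Inst F}
    (hI : I.DegreeLE D) : I.cstrs.length ≤ I.numVars * D := by
  calc I.cstrs.length
      ≤ ∑ v, degree I.cstrs v := by
        rw [← List.countP_true]
        exact countP_le_sum_degree _ _ (fun c _ => ⟨⟨0, har _ c.mem⟩, Finset.mem_univ _⟩) _
    _ ≤ ∑ _v : Fin I.numVars, D := Finset.sum_le_sum fun v _ => hI v
    _ = I.numVars * D := by simp

theorem div_eq_of_substVar_eq {l : List (Cstr (F ∪ {delta0, delta1}) n)} {d : ℕ} {v v' : Fin n}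
    (h : substVar l d v = substVar l d v') : (v : ℕ) / d = v' / d := by
  unfold substVar at h
  split_ifs at h
  · exact div_eq_of_pathVertex_eq (Fin.natAdd_injective _ _ h)
  · exact absurd (congrArg Fin.val h) (by simp only [Fin.val_natAdd, Fin.val_castAdd]; omega)
  · exact absurd (congrArg Fin.val h) (by simp only [Fin.val_natAdd, Fin.val_castAdd]; omega)
  · rw [Fin.castAdd_injective _ _ h]

theorem card_substVar_fiber_le (l : List (Cstr (F ∪ {delta0, delta1}) n)) {d : ℕ} (hd : 0 < d)
    (w : Fin (n + (numBlocks d n + numBlocks d n + 1))) :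
    (Finset.univ.filter fun v => substVar l d v = w).card ≤ d := by
  refine (Finset.card_le_card_of_injOn (t := Finset.range d) (fun v => v.val % d)
    (fun v _ => Finset.mem_coe.2 (Finset.mem_range.2 (Nat.mod_lt _ hd)))
    fun v hv v' hv' hmod => ?_).trans_eq (Finset.card_range d)
  have hdiv := div_eq_of_substVar_eq
    ((Finset.mem_filter.1 hv).2.trans (Finset.mem_filter.1 hv').2.symm)
  refine Fin.ext ?_
  rw [← Nat.div_add_mod v.val d, ← Nat.div_add_mod v'.val d, hdiv]
  exact congrArg _ hmod

theorem degree_residual_le {l : List (Cstr (F ∪ {delta0, delta1}) n)} {d D : ℕ} (hd : 0 < d)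
    (hl : ∀ v, degree l v ≤ D) (w : Fin (n + (numBlocks d n + numBlocks d n + 1))) :
    degree (residual l d) w ≤ d * D :=
  calc degree (residual l d) w
      ≤ ∑ v with substVar l d v = w, degree (unpinned l) v := degree_map_mapVars_le _ _ _
    _ ≤ ∑ v with substVar l d v = w, D :=
        Finset.sum_le_sum fun v _ => (degree_unpinned_le l v).trans (hl v)
    _ = (Finset.univ.filter fun v => substVar l d v = w).card * D := by simp
    _ ≤ d * D := Nat.mul_le_mul_right D (card_substVar_fiber_le l hd w)

theorem countP_finRange_le_one {m : ℕ} {P : Fin m → Bool}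
    (hP : ∀ b b', P b → P b' → b = b') : (List.finRange m).countP P ≤ 1 := by
  rw [List.countP_eq_length_filter,
    ← List.toFinset_card_of_nodup ((List.nodup_finRange m).filter _)]
  exact Finset.card_le_one.2 fun b hb b' hb' => hP b b' (by simpa using hb) (by simpa using hb')

theorem countP_pathEdges_le (m : ℕ) (w : Fin (n + (m + m + 1))) :
    (pathEdges m).countP (fun e => decide (Fin.natAdd n e.1 = w ∨ Fin.natAdd n e.2 = w)) ≤ 2 := by
  rw [pathEdges, List.countP_append, List.countP_map, List.countP_map]
  refine add_le_add (b := 1) (d := 1) ?_ ?_ <;>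
  · refine countP_finRange_le_one fun b b' hb hb' => Fin.ext ?_
    simp only [Function.comp_apply, decide_eq_true_eq, Fin.ext_iff, Fin.val_natAdd] at hb hb'
    omega

/-- The total number of gadgets in the binomials of `S`. -/
def numGadgets (S : List (Binomial ℂ (Gadget F))) : ℕ := (S.map fun s => s.2.length).sum

theorem sum_degree_onEdge_le {N : ℕ} (S : List (Binomial ℂ (Gadget F))) (e : Fin N × Fin N)
    (w : Fin N) :
    ((S.map (Binomial.map id (Gadget.onEdge e))).map fun s => degree s.2 w).sum ≤
      if e.1 = w ∨ e.2 = w then numGadgets S else 0 := by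
  rw [List.map_map]
  split_ifs with hw
  · exact List.sum_le_sum fun s _ => List.countP_le_length.trans (by simp [Binomial.map])
  · refine (List.sum_eq_zero fun z hz => ?_).le
    obtain ⟨s, _, rfl⟩ := List.mem_map.1 hz
    refine List.countP_eq_zero.2 fun c hc => ?_
    obtain ⟨g, _, rfl⟩ := List.mem_map.1 hc
    push Not at hw
    refine fun h => (of_decide_eq_true h).elim fun j => ?_
    simp only [Gadget.onEdge]
    split_ifs
    exacts [hw.2, hw.1]

theorem sum_map_ite_eq_countP_mul {β : Type*} (P : β → Prop) [DecidablePred P] (t : ℕ)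
    (l : List β) : (l.map fun b => if P b then t else 0).sum = l.countP P * t := by
  induction l with
  | nil => simp
  | cons b l ih =>
    rw [List.map_cons, List.sum_cons, ih, List.countP_cons]
    by_cases hb : P b <;> simp [hb, add_mul, add_comm]

theorem sum_degree_pathBinomials_le (S : List (Binomial ℂ (Gadget F))) (m : ℕ)
    (w : Fin (n + (m + m + 1))) :
    ((pathBinomials S n m).map fun s => degree s.2 w).sum ≤ 2 * numGadgets S := by
  rw [pathBinomials, List.map_flatMap, List.flatMap_def, List.sum_flatten, List.map_map]
  refine (List.sum_le_sum fun e _ => sum_degree_onEdge_le S _ w).trans ?_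
  rw [sum_map_ite_eq_countP_mul]
  exact Nat.mul_le_mul_right _ (countP_pathEdges_le m w)

/-- A bound for the degrees of the instances produced from an instance of degree at most `D`. -/
def degBound (S : List (Binomial ℂ (Gadget F))) (d D : ℕ) : ℕ := 2 * numGadgets S + d * D + 1

theorem degreeLE_of_mem_terms {S : List (Binomial ℂ (Gadget F))} {d D : ℕ} (hd : 0 < d)
    {l : List (Cstr (F ∪ {delta0, delta1}) n)} (hl : ∀ v, degree l v ≤ D)
    {p : List ℂ × List (Cstr F (n + (numBlocks d n + numBlocks d n + 1)))}
    (hp : p ∈ terms S d l) : (⟨_, p.2⟩ : Inst F).DegreeLE (degBound S d D) := fun w =>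
  calc degree p.2 w
      ≤ ((pathBinomials S n (numBlocks d n)).map fun s => degree s.2 w).sum +
          degree (residual l d) w := countP_le_of_mem_expand _ hp
    _ ≤ 2 * numGadgets S + d * D :=
        add_le_add (sum_degree_pathBinomials_le S _ w) (degree_residual_le hd hl w)
    _ ≤ degBound S d D := Nat.le_succ _

theorem IsPinning.coeff_mem_of_mem_terms {S : List (Binomial ℂ (Gadget F))} {k d : ℕ}
    (hS : IsPinning F S k) {l : List (Cstr (F ∪ {delta0, delta1}) n)}
    {p : List ℂ × List (Cstr F (n + (numBlocks d n + numBlocks d n + 1)))}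
    (hp : p ∈ terms S d l) : ∀ a ∈ p.1, a ∈ valueField F := by
  refine coeff_of_mem_expand (fun s hs => ?_) hp
  obtain ⟨e, _, hs⟩ := List.mem_flatMap.1 hs
  obtain ⟨t, ht, rfl⟩ := List.mem_map.1 hs
  exact hS.coeff t ht

end Degree

/-! ### Correctness of the reduction -/

section Naming

variable {F : Set BoolFn} {n : ℕ} {name : BoolFn → ℕ}

/-- The constraint `c` as it appears in an input. -/
def Cstr.named (name : BoolFn → ℕ) (c : Cstr F n) : NamedCstr :=
  (⟨name c.fn⟩, List.ofFn fun j => ⟨c.vars j⟩)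

/-- The instance `I` as it appears in an input. -/
def Inst.named (name : BoolFn → ℕ) (I : Inst F) : NamedInst :=
  (⟨I.numVars⟩, I.cstrs.map (Cstr.named name))

/-- The symbol for the gadget `g` that appears in an `EdgeBinomial`. -/
def Gadget.named (name : BoolFn → ℕ) (g : Gadget F) : Unary × List Bool :=
  (⟨name g.fn⟩, List.ofFn g.pattern)

/-- The naming of the functions in `F ∪ {delta0, delta1}` that `NamedInst.reduce` expects. -/
noncomputable def extName (name : BoolFn → ℕ) (f : BoolFn) : ℕ :=
  open Classical in if f = delta false then 0 else if f = delta true then 1 else name f + 2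

theorem enc_cstr_named (name : BoolFn → ℕ) (c : Cstr F n) : enc (c.named name) = c.enc name := by
  change Data.node _ (encList _) = Data.node _ (encList _)
  rw [Cstr.named, List.map_ofFn]
  rfl

theorem enc_inst_named (name : BoolFn → ℕ) (I : Inst F) : enc (I.named name) = I.enc name := by
  change Data.node _ (encList _) = Data.node _ (encList _)
  rw [Inst.named, List.map_map]
  exact congrArg (fun l => Data.node _ (encList l))
    (List.map_congr_left fun c _ => enc_cstr_named name c)

theorem Cstr.named_injective (h : Set.InjOn name F) :
    Function.Injective (Cstr.named name : Cstr F n → NamedCstr) := by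
  rintro ⟨f, hf, v⟩ ⟨f', hf', v'⟩ hc
  simp only [Cstr.named, Prod.mk.injEq, Unary.mk.injEq] at hc
  obtain rfl := h hf hf' hc.1
  obtain rfl : v = v' := funext fun j =>
    Fin.ext (Unary.mk.inj (congrFun (List.ofFn_injective hc.2) j))
  rfl

theorem Inst.named_injective (h : Set.InjOn name F) :
    Function.Injective (Inst.named name : Inst F → NamedInst) := by
  rintro ⟨n, l⟩ ⟨n', l'⟩ hI
  simp only [Inst.named, Prod.mk.injEq, Unary.mk.injEq] at hI
  obtain ⟨rfl, hl⟩ := hI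
  rw [List.map_injective_iff.2 (Cstr.named_injective h) hl]

theorem extName_of_forall_ne {f : BoolFn} (hf : ∀ b, f ≠ delta b) :
    extName name f = name f + 2 := by
  rw [extName, if_neg (hf false), if_neg (hf true)]

theorem extName_delta (b : Bool) : extName name (delta b) = b.toNat := by
  cases b <;> simp [extName, delta_injective.eq_iff]

theorem extName_eq_toNat_iff {f : BoolFn} {b : Bool} :
    extName name f = b.toNat ↔ f = delta b := by
  refine ⟨fun h => ?_, fun h => h ▸ extName_delta b⟩
  by_cases hf : ∀ b, f ≠ delta b
  · rw [extName_of_forall_ne hf] at h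
    have hb := b.toNat_le
    omega
  · push Not at hf
    obtain ⟨b', rfl⟩ := hf
    cases b <;> cases b' <;> simp_all [extName_delta]

theorem extName_injOn (h : Set.InjOn name F) :
    Set.InjOn (extName name) (F ∪ {delta0, delta1}) := by
  intro f hf g hg hfg
  by_cases hf' : ∀ b, f ≠ delta b
  · by_cases hg' : ∀ b, g ≠ delta b
    · rw [extName_of_forall_ne hf', extName_of_forall_ne hg'] at hfg
      exact h (mem_of_forall_ne_delta hf hf') (mem_of_forall_ne_delta hg hg')
        (Nat.add_right_cancel hfg)
    · push Not at hg'
      obtain ⟨b, rfl⟩ := hg'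
      exact extName_eq_toNat_iff.1 (hfg.trans (extName_delta b))
  · push Not at hf'
    obtain ⟨b, rfl⟩ := hf'
    exact (extName_eq_toNat_iff.1 (hfg.symm.trans (extName_delta b))).symm

end Naming

section NamedReduction

variable {F : Set BoolFn} {name : BoolFn → ℕ} {r : ℕ} {mat : ℂ → RatMat r}
  {S : List (Binomial ℂ (Gadget F))} {I : Inst (F ∪ {delta0, delta1})} {d : ℕ}

theorem isPinned_named {b : Bool} {v : Fin I.numVars} :
    (I.named (extName name)).isPinned b.toNat ⟨v⟩ = true ↔ IsPinned I.cstrs b v := by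
  simp only [NamedInst.isPinned, Inst.named, List.any_map, List.any_eq_true, Function.comp_apply,
    Cstr.named, Bool.and_eq_true, decide_eq_true_eq, List.mem_ofFn', Set.mem_range,
    exists_exists_eq_and]
  exact exists_congr fun c => and_congr_right fun _ => and_congr
    (decide_eq_true_iff.trans extName_eq_toNat_iff) (by simp [Fin.ext_iff])

theorem substVar_named (v : Fin I.numVars) :
    (I.named (extName name)).substVar d ⟨v⟩ = ⟨substVar I.cstrs d v⟩ := by
  have h₀ : (I.named (extName name)).isPinned 0 ⟨v⟩ = true ↔ IsPinned I.cstrs false v :=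
    isPinned_named (b := false)
  have h₁ : (I.named (extName name)).isPinned 1 ⟨v⟩ = true ↔ IsPinned I.cstrs true v :=
    isPinned_named (b := true)
  have hn : (I.named (extName name)).1.val = I.numVars := rfl
  rw [NamedInst.substVar, substVar]
  by_cases hp₀ : IsPinned I.cstrs false v
  · rw [if_pos (h₀.2 hp₀), if_pos ⟨_, hp₀⟩]
    simp [pinValue, hp₀, pathVertex, hn]
  · rw [if_neg (mt h₀.1 hp₀)]
    by_cases hp₁ : IsPinned I.cstrs true v
    · rw [if_pos (h₁.2 hp₁), if_pos ⟨_, hp₁⟩]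
      simp [pinValue, hp₀, pathVertex, hn, add_assoc]
    · rw [if_neg (mt h₁.1 hp₁), if_neg (by simp [hp₀, hp₁])]
      rfl

theorem onEdge_named {N : ℕ} (e : Fin N × Fin N) (g : Gadget F) :
    (g.onEdge e).named name = onEdge (⟨e.1⟩, ⟨e.2⟩) (g.named name) := by
  simp only [Cstr.named, Gadget.onEdge, onEdge, Gadget.named, List.map_ofFn]
  congr 2
  funext j
  simp only [Function.comp_apply]
  split_ifs <;> rfl

theorem namedPathEdges_eq (n m : ℕ) :
    namedPathEdges n m = (pathEdges m).map fun e =>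
      (⟨Fin.natAdd n e.1⟩, ⟨Fin.natAdd n e.2⟩) := by
  rw [namedPathEdges, pathEdges, ← List.map_coe_finRange_eq_range, List.map_map, List.map_map,
    List.map_append, List.map_map, List.map_map]
  rfl

theorem pathBinomials_named :
    (I.named (extName name)).pathBinomials (S.map (Binomial.map mat (Gadget.named name))) d =
      (pathBinomials S I.numVars (numBlocks d I.numVars)).map
        (Binomial.map mat (Cstr.named name)) := by
  rw [NamedInst.pathBinomials, pathBinomials, List.map_flatMap, Inst.named, namedPathEdges_eq,
    List.flatMap_map]
  refine congrArg (fun f => List.flatMap f _) (funext fun e => ?_)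
  simp only [List.map_map]
  refine List.map_congr_left fun s _ => ?_
  simp only [Function.comp_apply, Binomial.map, List.map_map, id]
  exact congrArg _ (List.map_congr_left fun g _ => (onEdge_named (_, _) g).symm)

theorem residual_named :
    (I.named (extName name)).residual d = (residual I.cstrs d).map (Cstr.named name) := by
  have key (l : List (Cstr (F ∪ {delta0, delta1}) I.numVars)) :
      ((l.map (Cstr.named (extName name))).filter fun c =>
        !decide (c.1.val = 0) && !decide (c.1.val = 1)).map (fun c =>
          ((⟨c.1.val - 1 - 1⟩ : Unary), c.2.map ((I.named (extName name)).substVar d))) =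
      ((unpinned l).map (Cstr.mapVars (substVar I.cstrs d))).map (Cstr.named name) := by
    induction l with
    | nil => rfl
    | cons c l ih =>
      by_cases hc : ∀ b, c.fn ≠ delta b
      · have hname := extName_of_forall_ne (name := name) hc
        rw [unpinned_cons_of_forall_ne hc, List.map_cons, List.filter_cons_of_pos
          (by simp [Cstr.named, hname]), List.map_cons, List.map_cons, List.map_cons, ih]
        congr 1
        simp only [Cstr.named, Cstr.mapVars, hname, List.map_ofFn]
        exact congrArg _ (congrArg List.ofFn (funext fun j => substVar_named _))
      · push Not at hc
        obtain ⟨b, hb⟩ := hc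
        rw [unpinned_cons_of_delta hb, List.map_cons, List.filter_cons_of_neg, ih]
        cases b <;> simp [Cstr.named, hb, extName_delta]
  exact key I.cstrs

theorem terms_named :
    (I.named (extName name)).terms (S.map (Binomial.map mat (Gadget.named name))) d =
      (terms S d I.cstrs).map fun p => (p.1.map mat, p.2.map (Cstr.named name)) := by
  rw [NamedInst.terms, pathBinomials_named, residual_named, expand_map, terms]

theorem hasConflict_named :
    (I.named (extName name)).hasConflict = true ↔
      ∃ v, IsPinned I.cstrs false v ∧ IsPinned I.cstrs true v := by
  simp only [NamedInst.hasConflict, NamedInst.varNames, List.any_map, List.any_eq_true,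
    List.mem_range, Function.comp_apply, Bool.and_eq_true, ← isPinned_named (name := name)]
  exact ⟨fun ⟨v, hv, h⟩ => ⟨⟨v, hv⟩, h⟩, fun ⟨v, h⟩ => ⟨v, v.2, h⟩⟩

open Classical in
theorem length_pinnedVars_named :
    (I.named (extName name)).pinnedVars.length =
      Fintype.card {v // ∃ b, IsPinned I.cstrs b v} := by
  rw [NamedInst.pinnedVars, NamedInst.varNames, ← List.map_coe_finRange_eq_range, List.map_map,
    List.filter_map, List.length_map, Fintype.card_subtype,
    ← List.toFinset_card_of_nodup ((List.nodup_finRange _).filter _)]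
  congr 1
  ext v
  simp only [Bool.exists_bool, ← isPinned_named (name := name), List.mem_toFinset, List.mem_filter,
    List.mem_finRange, true_and, Function.comp_apply, Bool.or_eq_true]
  exact Iff.symm (Finset.mem_filter.trans (and_iff_right (Finset.mem_univ v)))

theorem reduce_hasValue {k : ℕ} (hS : IsPinning F S k) {D : ℕ} (hd : 0 < d) {ω : Fin r → ℂ}
    (hmat : ∀ α ∈ valueField F, (mat α).IsMul ω α) {O : NamedInst → RatVec r}
    (hO : ∀ J : Inst F, J.DegreeLE (degBound S d D) → (O (J.named name)).HasValue ω J.value)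
    (hI : I.DegreeLE D) :
    ((I.named (extName name)).reduce (S.map (Binomial.map mat (Gadget.named name))) d k
      O).HasValue ω I.value := by
  unfold NamedInst.reduce
  split_ifs with hconflict
  · obtain ⟨v, h₀, h₁⟩ := hasConflict_named.1 hconflict
    rw [value_eq_zero_of_isPinned h₀ h₁]
    exact RatVec.HasValue.zero ω
  · have hpins : ∀ v, ¬(IsPinned I.cstrs false v ∧ IsPinned I.cstrs true v) := fun v hv =>
      hconflict (hasConflict_named.2 ⟨v, hv⟩)
    have hterm : ∀ p ∈ terms S d I.cstrs,
        (RatMat.appAll (p.1.map mat)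
          (O ((I.named (extName name)).onPath d (p.2.map (Cstr.named name))))).HasValue ω
            (p.1.prod * (⟨_, p.2⟩ : Inst F).value) := fun p hp =>
      RatVec.HasValue.appAll (fun a ha => hmat a (hS.coeff_mem_of_mem_terms hp a ha))
        (hO ⟨_, p.2⟩ (degreeLE_of_mem_terms hd hI hp))
    have hsum := (RatVec.HasValue.sum hterm).half_iterate
      ((I.named (extName name)).pinnedVars.length + k)
    rw [hS.sum_terms d hpins, length_pinnedVars_named,
      mul_div_cancel_left₀ _ (pow_ne_zero _ two_ne_zero)] at hsum
    rw [terms_named, List.map_map, length_pinnedVars_named]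
    exact hsum

end NamedReduction

open Asymptotics

/-! ### Running times -/

section Inputs

variable {F : Set BoolFn}

theorem valueField_union_delta (F : Set BoolFn) :
    valueField (F ∪ {delta0, delta1}) = valueField F := by
  refine le_antisymm (IntermediateField.adjoin_le_iff.2 ?_) (IntermediateField.adjoin.mono _ _ _ ?_)
  · rintro z ⟨f, hf | rfl | rfl, x, rfl⟩
    · exact toFun_mem_valueField hf x
    all_goals
      simp only [delta0, delta1]
      split_ifs
      exacts [one_mem _, zero_mem _]
  · rintro z ⟨f, hf, x, rfl⟩
    exact ⟨f, Or.inl hf, x, rfl⟩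

theorem IsValueBasis.card_eq {r r' : ℕ} {ω : Fin r → ℂ} {ω' : Fin r' → ℂ}
    (h : IsValueBasis F ω) (h' : IsValueBasis F ω') : r = r' := by
  have hspan : Submodule.span ℚ (Set.range ω) = Submodule.span ℚ (Set.range ω') :=
    Submodule.ext fun z => (h.2 z).trans (h'.2 z).symm
  have hr := finrank_span_eq_card h.1
  have hr' := finrank_span_eq_card h'.1
  rw [hspan, hr'] at hr
  simpa using hr.symm

theorem exists_height_enc_named_le (hfin : F.Finite) (har : ∀ f ∈ F, 0 < f.arity)
    (name : BoolFn → ℕ) (D : ℕ) :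
    ∃ K : ℕ, ∀ I : Inst F, I.DegreeLE D → (enc (I.named name)).height ≤ K * (I.numVars + 1) := by
  obtain ⟨A, hA⟩ := (hfin.image fun f => f.arity).bddAbove
  obtain ⟨M, hM⟩ := (hfin.image name).bddAbove
  refine ⟨D + A + M + 3, fun I hI => ?_⟩
  have hcstr : ∀ c ∈ I.cstrs.map (Cstr.named name), (enc c).height ≤ A + M + I.numVars + 1 := by
    intro c hc
    obtain ⟨c, _, rfl⟩ := List.mem_map.1 hc
    have harity : c.fn.arity ≤ A := hA ⟨_, c.mem, rfl⟩
    have hname : name c.fn ≤ M := hM ⟨_, c.mem, rfl⟩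
    have hvars := height_enc_list_le (l := List.ofFn fun j => Unary.mk (c.vars j))
      (m := I.numVars) fun a ha => by
        obtain ⟨j, rfl⟩ := (List.mem_ofFn' _ _).1 ha
        rw [height_enc_unary]
        exact (c.vars j).2.le
    rw [List.length_ofFn] at hvars
    simp only [Cstr.named, enc_mk, Data.height_node, height_enc_unary]
    omega
  have hcstrs := height_enc_list_le hcstr
  have hlength := length_le_numVars_mul har hI
  rw [List.length_map] at hcstrs
  simp only [Inst.named, enc_mk, Data.height_node, height_enc_unary]
  calc max I.numVars (enc (I.cstrs.map (Cstr.named name))).height + 1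
      ≤ I.numVars * D + (A + M) + 2 * I.numVars + 2 := by omega
    _ ≤ (D + A + M + 3) * (I.numVars + 1) := by nlinarith [Nat.zero_le ((A + M) * I.numVars)]

end Inputs

section Growth

theorem isBigO_two_rpow_of_le {δ ε : ℝ} (h : δ ≤ ε) :
    (fun n : ℕ => (2 : ℝ) ^ (δ * n)) =O[⊤] fun n : ℕ => (2 : ℝ) ^ (ε * n) := by
  refine isBigO_of_le _ fun n => ?_
  rw [Real.norm_of_nonneg (by positivity), Real.norm_of_nonneg (by positivity)]
  gcongr
  exact one_le_two

theorem isBigO_const_two_rpow (c : ℝ) {δ : ℝ} (hδ : 0 ≤ δ) :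
    (fun _ : ℕ => c) =O[⊤] fun n : ℕ => (2 : ℝ) ^ (δ * n) := by
  simpa using (isBigO_two_rpow_of_le hδ).const_mul_left c

theorem isBigO_natCast_two_rpow {δ : ℝ} (hδ : 0 < δ) :
    (fun n : ℕ => (n : ℝ)) =O[⊤] fun n : ℕ => (2 : ℝ) ^ (δ * n) := by
  refine isBigO_of_le' (c := (δ * Real.log 2)⁻¹) _ fun n => ?_
  rw [Real.norm_of_nonneg (by positivity), Real.norm_of_nonneg (by positivity), inv_mul_eq_div,
    le_div_iff₀ (mul_pos hδ (Real.log_pos one_lt_two)), Real.rpow_def_of_pos two_pos]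
  have hexp := Real.add_one_le_exp (Real.log 2 * (δ * n))
  linarith

end Growth

section Solver

/-- The tree of `x` encodes an instance of `#CSP(F)` of degree at most `D`. -/
def IsInput (F : Set BoolFn) (D : ℕ) (name : BoolFn → ℕ) (x : NamedInst) : Prop :=
  ∃ I : Inst F, I.DegreeLE D ∧ I.named name = x

/-- The witness of `HasAlgorithm`, with the output computed by the algorithm as a function of the
input and a bound `time` for the number of steps in terms of the number of variables. -/
structure Solver (F : Set BoolFn) (D r : ℕ) where
  name : BoolFn → ℕ
  basis : Fin r → ℂ
  prog : Prog
  out : NamedInst → RatVec r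
  time : ℕ → ℕ
  name_injOn : Set.InjOn name F
  isValueBasis : IsValueBasis F basis
  run : ∀ I : Inst F, I.DegreeLE D →
    RunWithin prog (enc (I.named name)) (enc (out (I.named name))) (time I.numVars)
  hasValue : ∀ I : Inst F, I.DegreeLE D → (out (I.named name)).HasValue basis I.value

variable {F : Set BoolFn} {D r : ℕ} {ε : ℝ}

theorem HasAlgorithm.exists_solver (h : HasAlgorithm F D ε) : ∃ (r : ℕ) (s : Solver F D r),
    (fun n => (s.time n : ℝ)) =O[⊤] fun n : ℕ => (2 : ℝ) ^ (ε * n) := by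
  obtain ⟨name, r, ω, p, C, hname, hω, hp⟩ := h
  have hout (x : NamedInst) : ∃ v : RatVec r, ∀ I : Inst F, I.DegreeLE D → I.named name = x →
      RunWithin p (enc x) (enc v) ⌊|C| * (2 : ℝ) ^ (ε * (I.numVars : ℝ))⌋₊ ∧
        v.HasValue ω I.value := by
    by_cases hx : IsInput F D name x
    · obtain ⟨I, hI, rfl⟩ := hx
      obtain ⟨y, t, hrun, hy, ht⟩ := hp I hI
      obtain ⟨v, rfl, hv⟩ := represents_iff.1 hy
      refine ⟨v, fun J _ hJI => ?_⟩
      rw [Inst.named_injective hname hJI, enc_inst_named]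
      refine ⟨⟨t, Nat.le_floor (ht.trans ?_), hrun⟩, hv⟩
      gcongr
      exact le_abs_self C
    · exact ⟨(1, 0), fun I hI hIx => absurd ⟨I, hI, hIx⟩ hx⟩
  choose out hout using hout
  refine ⟨r, ⟨name, ω, p, out, fun n => ⌊|C| * (2 : ℝ) ^ (ε * n)⌋₊, hname, hω,
    fun I hI => (hout _ I hI rfl).1, fun I hI => (hout _ I hI rfl).2⟩, ?_⟩
  refine isBigO_of_le' (c := |C|) _ fun n => ?_
  rw [Real.norm_of_nonneg (by positivity), Real.norm_of_nonneg (by positivity)]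
  exact Nat.floor_le (by positivity)

namespace Solver

theorem hasAlgorithm (s : Solver F D r)
    (hs : (fun n => (s.time n : ℝ)) =O[⊤] fun n : ℕ => (2 : ℝ) ^ (ε * n)) :
    HasAlgorithm F D ε := by
  obtain ⟨C, hC⟩ := isBigO_top.1 hs
  refine ⟨s.name, r, s.basis, s.prog, C, s.name_injOn, s.isValueBasis, fun I hI => ?_⟩
  obtain ⟨t, ht, hrun⟩ := s.run I hI
  rw [enc_inst_named] at hrun
  refine ⟨_, t, hrun, represents_iff.2 ⟨_, rfl, s.hasValue I hI⟩, ?_⟩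
  have hCn := hC I.numVars
  rw [Real.norm_of_nonneg (by positivity), Real.norm_of_nonneg (by positivity)] at hCn
  exact (Nat.cast_le.2 ht).trans hCn

open Classical in
/-- A matrix which describes the multiplication by `α`, or `0` if `α` is not in the value field. -/
noncomputable def mat (s : Solver F D r) (α : ℂ) : RatMat r :=
  if h : α ∈ valueField F then (s.isValueBasis.exists_isMul h).choose else (0, 0)

theorem isMul_mat (s : Solver F D r) {α : ℂ} (hα : α ∈ valueField F) :
    (s.mat α).IsMul s.basis α := by
  rw [mat, dif_pos hα]
  exact (s.isValueBasis.exists_isMul hα).choose_spec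

/-- The reduction with the algorithm `s` as its oracle. -/
noncomputable def reduce (s : Solver F D r) (S : List (Binomial ℂ (Gadget F))) (d k : ℕ)
    (x : NamedInst) : RatVec r :=
  x.reduce (S.map (Binomial.map s.mat (Gadget.named s.name))) d k s.out

end Solver

end Solver

section Reduction

variable {F : Set BoolFn} {S : List (Binomial ℂ (Gadget F))} {D r : ℕ}

/-- A bound for the number of oracle calls, plus the time `T` of the oracle on one of them. -/
def reduceBudget (S : List (Binomial ℂ (Gadget F))) (d : ℕ) (T : ℕ → ℕ) (n : ℕ) : ℕ :=
  2 ^ (2 * numBlocks d n * S.length) + T (n + (numBlocks d n + numBlocks d n + 1))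

theorem polyTime_reduce (k : ℕ) :
    PolyTime (⟨fun i => IsInput (F ∪ {delta0, delta1}) D (extName i.2.name),
        fun i x => reduceBudget S i.1 i.2.time x.1.val⟩ :
        Promise (Σ d : ℕ+, Solver F (degBound S d D) r) NamedInst)
      fun i x => i.2.reduce S i.1 k x := by
  refine PolyTime.reduce (Δ := ⟨fun i => IsInput F (degBound S i.1 D) i.2.name,
    fun i x => i.2.time x.1.val⟩) k (fun i => i.1.pos) ?_ ?_ ?_ ?_
  · refine ⟨fun i => i.2.prog, fun i x => i.2.time x.1.val, PolyBounded.budget _, ?_⟩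
    rintro i _ ⟨J, hJ, rfl⟩
    exact i.2.run J hJ
  · rintro i _ ⟨I, hI, rfl⟩ p hp
    rw [terms_named] at hp
    obtain ⟨q, hq, rfl⟩ := List.mem_map.1 hp
    exact ⟨⟨_, q.2⟩, degreeLE_of_mem_terms i.1.pos hI hq, rfl⟩
  · exact fun i x _ p _ => Nat.le_add_left _ _
  · intro i x _
    rw [NamedInst.length_pathBinomials, List.length_map]
    exact Nat.le_add_right _ _

theorem isBigO_two_pow_numBlocks (l : ℕ) {d : ℕ} (hd : 0 < d) {δ : ℝ} (h : 2 * (l : ℝ) ≤ δ * d) :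
    (fun n => ((2 ^ (2 * numBlocks d n * l) : ℕ) : ℝ)) =O[⊤]
      fun n : ℕ => (2 : ℝ) ^ (δ * n) := by
  refine isBigO_of_le' (c := 2 ^ (2 * l)) _ fun n => ?_
  rw [Real.norm_of_nonneg (by positivity), Real.norm_of_nonneg (by positivity)]
  have hexp : 2 * (l : ℝ) * ((n / d : ℕ) : ℝ) ≤ δ * n :=
    calc 2 * (l : ℝ) * ((n / d : ℕ) : ℝ) ≤ δ * d * (n / d) :=
          mul_le_mul h Nat.cast_div_le (by positivity) (le_trans (by positivity) h)
      _ = δ * n := by field_simp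
  calc ((2 ^ (2 * numBlocks d n * l) : ℕ) : ℝ)
      = 2 ^ (2 * l) * (2 : ℝ) ^ (2 * (l : ℝ) * ((n / d : ℕ) : ℝ)) := by
        rw [show 2 * (l : ℝ) * ((n / d : ℕ) : ℝ) = (2 * l * (n / d) : ℕ) by push_cast; rfl,
          Real.rpow_natCast, numBlocks]
        push_cast
        ring
    _ ≤ 2 ^ (2 * l) * (2 : ℝ) ^ (δ * n) := by
        gcongr
        exact one_le_two

theorem isBigO_comp_path {T : ℕ → ℕ} (d : ℕ) {δ : ℝ} (hδ : 0 ≤ δ)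
    (hT : (fun n => (T n : ℝ)) =O[⊤] fun n : ℕ => (2 : ℝ) ^ (δ / 3 * n)) :
    (fun n => (T (n + (numBlocks d n + numBlocks d n + 1)) : ℝ)) =O[⊤]
      fun n : ℕ => (2 : ℝ) ^ (δ * n) := by
  refine (hT.comp_tendsto Filter.tendsto_top).trans
    (isBigO_of_le' (c := (2 : ℝ) ^ δ) _ fun n => ?_)
  have hn : ((n + (numBlocks d n + numBlocks d n + 1) : ℕ) : ℝ) ≤ 3 * n + 3 := by
    have := Nat.div_le_self n d
    rw [numBlocks]
    exact_mod_cast (by omega)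
  rw [Function.comp_apply, Real.norm_of_nonneg (by positivity),
    Real.norm_of_nonneg (by positivity), ← Real.rpow_add two_pos]
  exact Real.rpow_le_rpow_of_exponent_le one_le_two (by nlinarith)

theorem isBigO_reduceBudget {T : ℕ → ℕ} {d : ℕ} (hd : 0 < d) {δ : ℝ} (hδ : 0 ≤ δ)
    (hSd : 2 * (S.length : ℝ) ≤ δ * d)
    (hT : (fun n => (T n : ℝ)) =O[⊤] fun n : ℕ => (2 : ℝ) ^ (δ / 3 * n)) :
    (fun n => (reduceBudget S d T n : ℝ)) =O[⊤] fun n : ℕ => (2 : ℝ) ^ (δ * n) := by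
  simpa only [reduceBudget, Nat.cast_add] using
    (isBigO_two_pow_numBlocks S.length hd hSd).add (isBigO_comp_path d hδ hT)

end Reduction

section Main

variable {F : Set BoolFn} {S : List (Binomial ℂ (Gadget F))} {k : ℕ}

theorem exists_solver_union_delta (hfin : F.Finite) (har : ∀ f ∈ F, 0 < f.arity)
    (hS : IsPinning F S k) (D r : ℕ) : ∃ B : ℕ, ∀ (d : ℕ+) (s : Solver F (degBound S d D) r),
      ∃ (c K : ℕ) (s' : Solver (F ∪ {delta0, delta1}) D r), ∀ n,
        s'.time n ≤ c * (reduceBudget S d s.time n + K * (n + 1) + 1) ^ B := by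
  obtain ⟨p, m, ⟨B, hB⟩, hrun⟩ := polyTime_reduce (S := S) (D := D) (r := r) k
  refine ⟨B, fun d s => ?_⟩
  obtain ⟨c, hc⟩ := hB ⟨d, s⟩
  obtain ⟨K, hK⟩ := exists_height_enc_named_le (hfin.union (Set.toFinite {delta0, delta1}))
    (by rintro f (hf | rfl | rfl); exacts [har f hf, Nat.one_pos, Nat.one_pos])
    (extName s.name) D
  refine ⟨c, K, ⟨extName s.name, s.basis, p ⟨d, s⟩, s.reduce S d k,
    fun n => c * (reduceBudget S d s.time n + K * (n + 1) + 1) ^ B, extName_injOn s.name_injOn,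
    ⟨s.isValueBasis.1, by simpa only [valueField_union_delta] using s.isValueBasis.2⟩,
    fun I hI => ?_, fun I hI => ?_⟩, fun n => le_rfl⟩
  · refine (hrun ⟨d, s⟩ _ ⟨I, hI, rfl⟩).mono ((hc _ ⟨I, hI, rfl⟩).trans ?_)
    have hheight := hK I hI
    simp only [Promise.size]
    gcongr
    exact le_rfl
  · exact reduce_hasValue hS d.pos (fun α hα => s.isMul_mat hα) s.hasValue hI

theorem isBigO_time_pow {T : ℕ → ℕ} {δ ε : ℝ} (hδ : 0 < δ) (c K B : ℕ) (hB : δ * B ≤ ε)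
    (hT : (fun n => (T n : ℝ)) =O[⊤] fun n : ℕ => (2 : ℝ) ^ (δ * n)) :
    (fun n => ((c * (T n + K * (n + 1) + 1) ^ B : ℕ) : ℝ)) =O[⊤]
      fun n : ℕ => (2 : ℝ) ^ (ε * n) := by
  have hone := isBigO_const_two_rpow 1 hδ.le
  have hsize := (hT.add (((isBigO_natCast_two_rpow hδ).add hone).const_mul_left K)).add hone
  have hpow : (fun n : ℕ => ((2 : ℝ) ^ (δ * n)) ^ B) =O[⊤] fun n : ℕ => (2 : ℝ) ^ (ε * n) := by
    refine (isBigO_two_rpow_of_le hB).congr_left fun n => ?_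
    rw [← Real.rpow_mul_natCast two_pos.le, mul_right_comm]
  exact_mod_cast ((hsize.pow B).trans hpow).const_mul_left (c : ℝ)

theorem hasAlgorithm_union_delta (hfin : F.Finite) (har : ∀ f ∈ F, 0 < f.arity)
    (h : ∀ ε' : ℝ, 0 < ε' → ∀ D' : ℕ, 0 < D' → HasAlgorithm F D' ε') {ε : ℝ} (hε : 0 < ε)
    (D : ℕ) : HasAlgorithm (F ∪ {delta0, delta1}) D ε := by
  obtain ⟨S, k, hS⟩ := exists_isPinning F
  obtain ⟨r, s₀, _⟩ := (h 1 one_pos 1 one_pos).exists_solver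
  obtain ⟨B, hB⟩ := exists_solver_union_delta hfin har hS D r
  obtain ⟨δ, hδ, hδB⟩ : ∃ δ : ℝ, 0 < δ ∧ δ * B ≤ ε :=
    ⟨ε / (B + 1), by positivity, by
      rw [div_mul_eq_mul_div, div_le_iff₀ (by positivity)]
      nlinarith⟩
  obtain ⟨d, hd⟩ : ∃ d : ℕ+, 2 * (S.length : ℝ) ≤ δ * (d : ℕ) := by
    obtain ⟨d, hd⟩ := exists_nat_ge (2 * (S.length : ℝ) / δ)
    refine ⟨d.succPNat, ?_⟩
    rw [div_le_iff₀' hδ] at hd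
    exact hd.trans (by gcongr; exact d.le_succ)
  obtain ⟨r', s, hs⟩ := (h (δ / 3) (by positivity) (degBound S d D) (Nat.succ_pos _)).exists_solver
  obtain rfl := s₀.isValueBasis.card_eq s.isValueBasis
  obtain ⟨c, K, s', hs'⟩ := hB d s
  refine s'.hasAlgorithm ((isBigO_of_le _ fun n => ?_).trans
    (isBigO_time_pow hδ c K B hδB (isBigO_reduceBudget d.pos hδ.le hd hs)))
  simpa only [Real.norm_natCast, Nat.cast_le] using hs' n

end Main

end PinCSP

theorem theorem1p1 (F : Set BoolFn) (hfin : F.Finite)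
    (halg : ∀ f ∈ F, ∀ x, IsAlgebraic ℚ (f.toFun x))
    (har : ∀ f ∈ F, 0 < f.arity)
    (hhard : ∃ ε : ℝ, 0 < ε ∧ ∃ D : ℕ, 0 < D ∧
      ¬ HasAlgorithm (F ∪ {delta0, delta1}) D ε) :
    ∃ ε' : ℝ, 0 < ε' ∧ ∃ D' : ℕ, 0 < D' ∧ ¬ HasAlgorithm F D' ε' := by
  by_contra hcon
  push Not at hcon
  obtain ⟨ε, hε, D, _, hno⟩ := hhard
  exact hno (hasAlgorithm_union_delta hfin har hcon hε D)
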